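/- Let $\mathcal{A}$ be a complete and cocomplete abelian category, and let $(\mathcal{X},\mathcal{Y})$ be an admissible balanced pair of full subcategories of $\mathcal{A}$, both closed under isomorphisms and direct summands. That is: - every object $M$ has a right $\mathcal{X}$-approximation (a morphism $X\to M$ with $X\in\mathcal{X}$ through which every morphism from an object of $\mathcal{X}$ to $M$ factors) and, dually, a left $\mathcal{Y}$-approximation; - for every object $M$ there is a complex $\cdots\to X_1\to X_0\to M\to 0$ with all $X_i\in\mathcal{X}$, and a complex $0\to M\to Y^0\to Y^1\to\cdots$ with all $Y^i\in\mathcal{Y}$, both of which become acyclic after applying $\mathrm{Hom}_{\mathcal{A}}(X,-)$ for any $X\in\mathcal{X}$ and after applying $\mathrm{Hom}_{\mathcal{A}}(-,Y)$ for any $Y\in\mathcal{Y}$; - every right $\mathcal{X}$-approximation is an epimorphism and every left $\mathcal{Y}$-approximation is a monomorphism. Let $\mathcal{E}$ be the class of short exact sequences in $\mathcal{A}$ which remain exact after applying $\mathrm{Hom}_{\mathcal{A}}(X,-)$ for every $X\in\mathcal{X}$, and let $\mathrm{Ch}(\mathcal{A},\mathcal{E})$ be the category of $\mathbb{Z}$-indexed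 chain complexes over $\mathcal{A}$ with the class $\mathrm{Ch}(\mathcal{E})$ of those short exact sequences of complexes which lie in $\mathcal{E}$ in each degree. Let $\mathrm{Ext}^1_{\mathrm{Ch}(\mathcal{E})}(C,D)$ be the group of equivalence classes of sequences $0\to D\to E\to C\to 0$ in $\mathrm{Ch}(\mathcal{E})$. Let $\mathcal{E}\text{-}\mathrm{dw}\widetilde{\mathcal{X}}$ be the class of complexes all of whose terms lie in $\mathcal{X}$, and let $(\mathcal{E}\text{-}\mathrm{dw}\widetilde{\mathcal{X}})^{\perp}$ be the class of complexes $K$ with $\mathrm{Ext}^1_{\mathrm{Ch}(\mathcal{E})}(X,K)=0$ for all $X\in\mathcal{E}\text{-}\mathrm{dw}\widetilde{\mathcal{X}}$. If $(\mathcal{E}\text{-}\mathrm{dw}\widetilde{\mathcal{X}})^{\perp}$ is closed under (set-indexed) direct sums, then $(\mathcal{F},\mathcal{C})=(\mathcal{E}\text{-}\mathrm{dw}\widetilde{\mathcal{X}},(\mathcal{E}\text{-}\mathrm{dw}\widetilde{\mathcal{X}})^{\perp})$ is a complete hereditary cotorsion pair in $\mathrm{Ch}(\mathcal{A},\mathcal{E})$.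 That is: - $\mathcal{C}=\mathcal{F}^{\perp}$, and $\mathcal{F}={}^{\perp}\mathcal{C}$ is the class of all complexes $F$ with $\mathrm{Ext}^1_{\mathrm{Ch}(\mathcal{E})}(F,K)=0$ for all $K\in\mathcal{C}$; - for every sequence $0\to S_1\to S_2\to S_3\to 0$ in $\mathrm{Ch}(\mathcal{E})$, if $S_2,S_3\in\mathcal{F}$ then $S_1\in\mathcal{F}$, and if $S_1,S_2\in\mathcal{C}$ then $S_3\in\mathcal{C}$; - for every complex $M$ there are sequences $0\to K\to X\to M\to 0$ and $0\to M\to K'\to X'\to 0$ in $\mathrm{Ch}(\mathcal{E})$ with $X,X'\in\mathcal{F}$ and $K,K'\in\mathcal{C}$. -/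

import Mathlib

open CategoryTheory CategoryTheory.Limits Opposite

universe v u

namespace RelComplexes

section ExactStructure

variable {C : Type u} [Category.{v} C] [HasZeroMorphisms C]

/-- A short exact sequence `K ⟶ mid ⟶ X` belonging to the class `Q` of short exact sequences. -/
structure Extension (Q : ObjectProperty (ShortComplex C)) (X K : C) where
  mid : C
  i : K ⟶ mid
  p : mid ⟶ X
  zero : i ≫ p = 0
  mem : Q (ShortComplex.mk i p zero)

/-- Yoneda equivalence of extensions: an isomorphism of the middle terms which is compatible with
the maps from `K` and to `X`. -/
def extensionSetoid (Q : ObjectProperty (ShortComplex C)) (X K : C) :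
    Setoid (Extension Q X K) where
  r e e' := ∃ φ : e.mid ≅ e'.mid, e.i ≫ φ.hom = e'.i ∧ φ.hom ≫ e'.p = e.p
  iseqv :=
    { refl := fun e => ⟨Iso.refl _, by simp, by simp⟩
      symm := by
        rintro e e' ⟨φ, h₁, h₂⟩
        exact ⟨φ.symm, by simp [← h₁], by simp [← h₂]⟩
      trans := by
        rintro e e' e'' ⟨φ, h₁, h₂⟩ ⟨ψ, h₃, h₄⟩
        exact ⟨φ ≪≫ ψ, by simp [reassoc_of% h₁, h₃], by simp [h₂, h₄]⟩ }

/-- The Yoneda `Ext¹(X, K)` relative to the class `Q` of short exact sequences: the equivalence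
classes of short exact sequences `K ⟶ E ⟶ X` in `Q`. Its zero element is the class of the split
sequence, so that it vanishes exactly when it has only one element. -/
def Ext1 (Q : ObjectProperty (ShortComplex C)) (X K : C) : Type (max u v) :=
  Quotient (extensionSetoid Q X K)

/-- The right orthogonal `F^⊥`: all `K` with `Ext¹(X, K) = 0` for every `X` in `F`. -/
def rightPerp (Q : ObjectProperty (ShortComplex C)) (F : ObjectProperty C) : ObjectProperty C :=
  fun K => ∀ X, F X → Subsingleton (Ext1 Q X K)

/-- The left orthogonal `^⊥G`: all `X` with `Ext¹(X, K) = 0` for every `K` in `G`. -/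
def leftPerp (Q : ObjectProperty (ShortComplex C)) (G : ObjectProperty C) : ObjectProperty C :=
  fun X => ∀ K, G K → Subsingleton (Ext1 Q X K)

/-- `(F, G)` is a cotorsion pair: `F = ^⊥G` and `G = F^⊥`. -/
structure IsCotorsionPair (Q : ObjectProperty (ShortComplex C)) (F G : ObjectProperty C) :
    Prop where
  left_eq : F = leftPerp Q G
  right_eq : G = rightPerp Q F

/-- `F` is closed under kernels of admissible epimorphisms between objects of `F`, and `G` is closed
under cokernels of admissible monomorphisms between objects of `G`. -/
structure IsHereditary (Q : ObjectProperty (ShortComplex C)) (F G : ObjectProperty C) :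
    Prop where
  kernel_mem : ∀ S : ShortComplex C, Q S → F S.X₂ → F S.X₃ → F S.X₁
  cokernel_mem : ∀ S : ShortComplex C, Q S → G S.X₁ → G S.X₂ → G S.X₃

/-- Every object `M` has short exact sequences `K ⟶ X ⟶ M` and `M ⟶ K' ⟶ X'` in `Q` with `X`, `X'` in
`F` and `K`, `K'` in `G`. -/
structure IsComplete (Q : ObjectProperty (ShortComplex C)) (F G : ObjectProperty C) :
    Prop where
  precover : ∀ M : C, ∃ (X K : C) (i : K ⟶ X) (p : X ⟶ M) (w : i ≫ p = 0),
    F X ∧ G K ∧ Q (ShortComplex.mk i p w)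
  preenvelope : ∀ M : C, ∃ (K X : C) (i : M ⟶ K) (p : K ⟶ X) (w : i ≫ p = 0),
    G K ∧ F X ∧ Q (ShortComplex.mk i p w)

end ExactStructure

section Balanced

variable {A : Type u} [Category.{v} A] [Abelian A]

/-- `f : X ⟶ M` is a right `𝒳`-approximation of `M`. -/
def IsRightApproximation (𝒳 : ObjectProperty A) {X M : A} (f : X ⟶ M) : Prop :=
  𝒳 X ∧ ∀ (X' : A) (g : X' ⟶ M), 𝒳 X' → ∃ h : X' ⟶ X, h ≫ f = g

/-- `f : M ⟶ Y` is a left `𝒴`-approximation of `M`. -/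
def IsLeftApproximation (𝒴 : ObjectProperty A) {M Y : A} (f : M ⟶ Y) : Prop :=
  𝒴 Y ∧ ∀ (Y' : A) (g : M ⟶ Y'), 𝒴 Y' → ∃ h : Y ⟶ Y', f ≫ h = g

/-- The complex `K` is right `𝒳`-acyclic: `Hom(X, K)` is acyclic for every `X` in `𝒳`. -/
def RightAcyclic (𝒳 : ObjectProperty A) {ι : Type} {c : ComplexShape ι}
    (K : HomologicalComplex A c) : Prop :=
  ∀ X : A, 𝒳 X →
    (((preadditiveCoyoneda.obj (op X)).mapHomologicalComplex c).obj K).Acyclic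

/-- The complex `K` is left `𝒴`-acyclic: `Hom(K, Y)` is acyclic for every `Y` in `𝒴`. -/
def LeftAcyclic (𝒴 : ObjectProperty A) {ι : Type} {c : ComplexShape ι}
    (K : HomologicalComplex A c) : Prop :=
  ∀ Y : A, 𝒴 Y →
    (((preadditiveYoneda.obj Y).mapHomologicalComplex c.symm).obj K.op).Acyclic

/-- `(𝒳, 𝒴)` is an admissible balanced pair. In the two resolution fields the augmented complexes
are `⋯ ⟶ X₁ ⟶ X₀ ⟶ M ⟶ 0` and `0 ⟶ M ⟶ Y⁰ ⟶ Y¹ ⟶ ⋯`. -/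
structure IsAdmissibleBalancedPair (𝒳 𝒴 : ObjectProperty A) : Prop where
  contravariantlyFinite : ∀ M : A, ∃ (X : A) (f : X ⟶ M), IsRightApproximation 𝒳 f
  covariantlyFinite : ∀ M : A, ∃ (Y : A) (f : M ⟶ Y), IsLeftApproximation 𝒴 f
  resolution : ∀ M : A, ∃ (P : ChainComplex A ℕ) (ε : P.X 0 ⟶ M) (w : P.d 1 0 ≫ ε = 0),
    (∀ n, 𝒳 (P.X n)) ∧ RightAcyclic 𝒳 (P.augment ε w) ∧ LeftAcyclic 𝒴 (P.augment ε w)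
  coresolution : ∀ M : A, ∃ (I : CochainComplex A ℕ) (η : M ⟶ I.X 0) (w : η ≫ I.d 0 1 = 0),
    (∀ n, 𝒴 (I.X n)) ∧ LeftAcyclic 𝒴 (I.augment η w) ∧ RightAcyclic 𝒳 (I.augment η w)
  epi_of_isRightApproximation : ∀ {X M : A} (f : X ⟶ M), IsRightApproximation 𝒳 f → Epi f
  mono_of_isLeftApproximation : ∀ {M Y : A} (f : M ⟶ Y), IsLeftApproximation 𝒴 f → Mono f

/-- The class `ℰ` of short exact sequences in `A` which remain exact after applying `Hom(X, -)` for
every `X` in `𝒳`. -/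
def relExact (𝒳 : ObjectProperty A) : ObjectProperty (ShortComplex A) :=
  fun S => S.ShortExact ∧ ∀ X : A, 𝒳 X → (S.map (preadditiveCoyoneda.obj (op X))).ShortExact

/-- The class `Ch(ℰ)` of short exact sequences of complexes (indexed by `ℤ`, with differentials of
degree `-1`) which belong to `ℰ` in each degree. -/
def chRelExact (𝒳 : ObjectProperty A) : ObjectProperty (ShortComplex (ChainComplex A ℤ)) :=
  fun S => S.ShortExact ∧
    ∀ n : ℤ, relExact 𝒳 (S.map (HomologicalComplex.eval A (ComplexShape.down ℤ) n))

/-- The class of complexes all of whose terms lie in `𝒳`. -/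
def dw (𝒳 : ObjectProperty A) : ObjectProperty (ChainComplex A ℤ) :=
  fun K => ∀ n : ℤ, 𝒳 (K.X n)

end Balanced

end RelComplexes

/-! A sequence in `ℰ` ending in an object of `𝒳` splits, so a sequence in `Ch(ℰ)` ending in a
complex `X` with terms in `𝒳` splits in each degree. Such sequences are classified by homotopy
classes of maps `X ⟶ K[1]`. Hence the right orthogonal for `Ext¹` is the right orthogonal `𝒫^⊥`, in
the homotopy category, of the class `𝒫` of complexes with terms in `𝒳`
(`rightPerp_iff_rightOrthogonal`).

Special preenvelopes therefore amount to triangles `P ⟶ M ⟶ W` with `P` in `𝒫` and `W` in `𝒫^⊥`. The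
`M` admitting one form a triangulated subcategory
(`isTriangulated_extensionProduct_rightOrthogonal`). It contains an object of `A` placed in one
degree: its augmented `𝒳`-resolution lies in `𝒫^⊥`, since maps into it from any complex in `𝒫`,
bounded or not, are null-homotopic. By induction on length it contains the bounded complexes. As `𝒫`
is closed under coproducts, and `𝒫^⊥` is by hypothesis, so is the subcategory. An arbitrary complex
is the union of bounded subcomplexes which stabilize in each degree, so its telescope sequence is
degreewise split and two-out-of-three applies (`hasEnvelope`).

Special precovers follow by Salce's pushout argument, and they give `F = ^⊥C`: a special precover of
an object of `^⊥C` splits. -/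

namespace RelComplexes

/-! ### Relative exactness and closure properties of `𝒳` -/

section Relative

variable {A : Type u} [Category.{v} A] [Abelian A] {𝒳 𝒴 : ObjectProperty A}

lemma relExact.exists_lift {S : ShortComplex A} (hS : relExact 𝒳 S) {X : A} (hX : 𝒳 X)
    (g : X ⟶ S.X₃) : ∃ h : X ⟶ S.X₂, h ≫ S.g = g := by
  have := (hS.2 X hX).epi_g
  exact (AddCommGrpCat.epi_iff_surjective _).1 this g

lemma relExact_of_exists_lift {S : ShortComplex A} (hS : S.ShortExact)
    (h : ∀ (X : A) (_ : 𝒳 X) (g : X ⟶ S.X₃), ∃ h : X ⟶ S.X₂, h ≫ S.g = g) :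
    relExact 𝒳 S := by
  refine ⟨hS, fun X hX => ?_⟩
  have := hS.mono_f
  exact
    { exact := by
        rw [ShortComplex.ab_exact_iff]
        intro x hx
        exact ⟨hS.exact.lift x hx, hS.exact.lift_f x hx⟩
      mono_f := by
        rw [AddCommGrpCat.mono_iff_injective]
        intro x y hxy
        exact (cancel_mono S.f).1 hxy
      epi_g := by
        rw [AddCommGrpCat.epi_iff_surjective]
        exact h X hX }

lemma relExact_of_splitting {S : ShortComplex A} (σ : S.Splitting) : relExact 𝒳 S :=
  relExact_of_exists_lift σ.shortExact fun _ _ g => ⟨g ≫ σ.s, by simp⟩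

lemma relExact.nonempty_splitting {S : ShortComplex A} (hS : relExact 𝒳 S) (h₃ : 𝒳 S.X₃) :
    Nonempty S.Splitting := by
  obtain ⟨s, hs⟩ := hS.exists_lift h₃ (𝟙 _)
  have := hS.1.mono_f
  exact ⟨ShortComplex.Splitting.ofExactOfSection S hS.1.exact s hs hS.1.mono_f⟩

/-- A split approximation exhibits `M` as a retract of an object of `𝒳`. This gives closure of `𝒳`
under coproducts, because a section can be built from lifts of the inclusions. -/
lemma IsAdmissibleBalancedPair.mem_of_section [𝒳.IsStableUnderRetracts]
    (hXY : IsAdmissibleBalancedPair 𝒳 𝒴) (M : A)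
    (h : ∀ (X : A) (f : X ⟶ M), IsRightApproximation 𝒳 f → ∃ s : M ⟶ X, s ≫ f = 𝟙 M) : 𝒳 M := by
  obtain ⟨X, f, hf⟩ := hXY.contravariantlyFinite M
  obtain ⟨s, hs⟩ := h X f hf
  exact 𝒳.prop_of_retract ⟨s, f, hs⟩ hf.1

lemma IsAdmissibleBalancedPair.mem_of_isZero [𝒳.IsStableUnderRetracts]
    (hXY : IsAdmissibleBalancedPair 𝒳 𝒴) {M : A} (hM : IsZero M) : 𝒳 M :=
  hXY.mem_of_section M fun _ _ _ => ⟨0, hM.eq_of_src _ _⟩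

lemma IsAdmissibleBalancedPair.mem_biprod [𝒳.IsStableUnderRetracts]
    (hXY : IsAdmissibleBalancedPair 𝒳 𝒴) {M N : A} (hM : 𝒳 M) (hN : 𝒳 N) : 𝒳 (M ⊞ N) :=
  hXY.mem_of_section _ fun X f hf => by
    obtain ⟨a, ha⟩ := hf.2 M biprod.inl hM
    obtain ⟨b, hb⟩ := hf.2 N biprod.inr hN
    exact ⟨biprod.desc a b, by ext <;> simp [ha, hb]⟩

lemma IsAdmissibleBalancedPair.mem_of_splitting [𝒳.IsStableUnderRetracts]
    (hXY : IsAdmissibleBalancedPair 𝒳 𝒴) {S : ShortComplex A} (σ : S.Splitting)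
    (h₁ : 𝒳 S.X₁) (h₃ : 𝒳 S.X₃) : 𝒳 S.X₂ :=
  𝒳.prop_of_iso σ.isoBinaryBiproduct.symm (hXY.mem_biprod h₁ h₃)

lemma IsAdmissibleBalancedPair.mem_sigma [𝒳.IsStableUnderRetracts]
    (hXY : IsAdmissibleBalancedPair 𝒳 𝒴) {ι : Type v} (M : ι → A) [HasCoproduct M]
    (hM : ∀ i, 𝒳 (M i)) : 𝒳 (∐ M) :=
  hXY.mem_of_section _ fun X f hf => by
    choose a ha using fun i => hf.2 (M i) (Sigma.ι M i) (hM i)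
    exact ⟨Sigma.desc a, by ext i; simp [ha]⟩

lemma IsAdmissibleBalancedPair.epi_of_exists_lift
    (hXY : IsAdmissibleBalancedPair 𝒳 𝒴) {X M : A} (f : X ⟶ M)
    (hf : ∀ (X' : A) (g : X' ⟶ M), 𝒳 X' → ∃ h : X' ⟶ X, h ≫ f = g) : Epi f := by
  obtain ⟨X', f', hf'⟩ := hXY.contravariantlyFinite M
  obtain ⟨h, rfl⟩ := hf X' f' hf'.1
  have := hXY.epi_of_isRightApproximation _ hf'
  exact epi_of_epi h f

end Relative

/-! ### Null-homotopic maps into right acyclic complexes -/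

section NullHomotopy

variable {A : Type u} [Category.{v} A] [Abelian A] {𝒳 : ObjectProperty A}

lemma RightAcyclic.exists_lift {ι : Type} {c : ComplexShape ι} {K : HomologicalComplex A c}
    (hK : RightAcyclic 𝒳 K) {X : A} (hX : 𝒳 X) {i j k : ι} (hi : c.prev j = i) (hk : c.next j = k)
    (x : X ⟶ K.X j) (hx : x ≫ K.d j k = 0) : ∃ y : X ⟶ K.X i, y ≫ K.d i j = x := by
  have h := (HomologicalComplex.exactAt_iff' _ i j k hi hk).1 (hK X hX j)
  exact (ShortComplex.ab_exact_iff _).1 h x hx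

/-- A morphism from a nonnegative complex with terms in `𝒳` to a right `𝒳`-acyclic nonnegative
complex is null-homotopic. -/
lemma RightAcyclic.nonempty_homotopy_zero {P L : ChainComplex A ℕ} (hP : ∀ n, 𝒳 (P.X n))
    (hL : RightAcyclic 𝒳 L) (f : P ⟶ L) : Nonempty (Homotopy f 0) := by
  -- The differential leaving degree 0 is `d 0 0 = 0`, so `f.f 0` is a cycle and the homotopy can
  -- start there. It is then built upwards.
  obtain ⟨h₀, hh₀⟩ := hL.exists_lift (hP 0) (i := 1) (k := 0) (by simp) (by simp) (f.f 0) (by simp)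
  have step (n : ℕ) (g : P.X n ⟶ L.X (n + 1))
      (hg : P.d (n + 1) n ≫ g ≫ L.d (n + 1) n = P.d (n + 1) n ≫ f.f n) :
      ∃ g' : P.X (n + 1) ⟶ L.X (n + 2),
        f.f (n + 1) = P.d (n + 1) n ≫ g + g' ≫ L.d (n + 2) (n + 1) := by
    obtain ⟨g', hg'⟩ := hL.exists_lift (hP (n + 1)) (j := n + 1) (i := n + 2) (k := n) (by simp)
      (by simp) (f.f (n + 1) - P.d (n + 1) n ≫ g) (by
        rw [Preadditive.sub_comp, Category.assoc, hg, f.comm, sub_self])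
    exact ⟨g', by rw [hg']; abel⟩
  have one := step 0 h₀ (by rw [hh₀])
  refine ⟨Homotopy.mkInductive f h₀ hh₀.symm one.choose one.choose_spec fun n p => ?_⟩
  have h := step (n + 1) p.2.1 (by
    have hp := congr(P.d (n + 2) (n + 1) ≫ $(p.2.2))
    rw [Preadditive.comp_add, HomologicalComplex.d_comp_d_assoc, zero_comp, zero_add] at hp
    exact hp.symm)
  exact ⟨h.choose, h.choose_spec⟩

open ComplexShape in
-- The target vanishes in positive degrees, so `f` factors through the brutal truncation of `Q` to
-- degrees `≤ 0`. This is why no bound on `Q` is needed.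
lemma RightAcyclic.nonempty_homotopy_zero_extend {Q : CochainComplex A ℤ} (hQ : ∀ n, 𝒳 (Q.X n))
    {L : ChainComplex A ℕ} (hL : RightAcyclic 𝒳 L) (f : Q ⟶ L.extend embeddingDownNat) :
    Nonempty (Homotopy f 0) := by
  let e := embeddingDownNat
  obtain ⟨h⟩ := RightAcyclic.nonempty_homotopy_zero (P := Q.restriction e)
    (fun n => hQ _) hL (e.homRestrict f)
  have lift : e.HasLift (𝟙 (Q.restriction e)) :=
    fun j hj => hj.false_of_isTruncLE.elim
  have hf : e.liftExtend _ lift ≫ HomologicalComplex.extendMap (e.homRestrict f) e = f := by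
    apply (e.homEquiv Q L).injective
    ext1
    simp [e.homRestrict_comp_extendMap]
  exact ⟨(Homotopy.ofEq hf.symm).trans (((h.extend e).compLeft (e.liftExtend _ lift)).trans
    (Homotopy.ofEq (by simp)))⟩

end NullHomotopy

/-! ### Extensions of a triangulated subcategory by its right orthogonal -/

section Orthogonal

open ObjectProperty Pretriangulated

variable {D : Type*} [Category* D] [HasZeroObject D] [HasShift D ℤ] [Preadditive D]
  [∀ n : ℤ, (shiftFunctor D n).Additive] [Pretriangulated D]

/-- In a triangle `W ⟶ M ⟶ X ⟶ W[1]` with `X` in `P` and `W` in `P^⊥` the last map is zero, so `M`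
is a direct sum and the factors can be exchanged. -/
lemma extensionProduct_rightOrthogonal_le (P : ObjectProperty D) [P.IsStableUnderShift ℤ] :
    extensionProduct P.rightOrthogonal P ≤ extensionProduct P P.rightOrthogonal := by
  rintro M ⟨W, X, f, g, h, hT, hW, hX⟩
  obtain ⟨e, -⟩ := exists_iso_binaryBiproduct_of_distTriang _ hT
    (P.rightOrthogonal.le_shift (1 : ℤ) _ hW h hX)
  exact (extensionProduct P P.rightOrthogonal).prop_of_iso
    (show X ⊞ W ≅ M from biprod.braiding _ _ ≪≫ e.symm)
    ⟨X, W, _, _, _, binaryBiproductTriangle_distinguished X W, hX, hW⟩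

/-- By associativity `(P * P^⊥) * (P * P^⊥) = P * (P^⊥ * P) * P^⊥`. Exchanging the middle factors
puts it inside `(P * P) * (P^⊥ * P^⊥)`, hence inside `P * P^⊥`. -/
lemma isTriangulated_extensionProduct_rightOrthogonal [IsTriangulated D] (P : ObjectProperty D)
    [P.IsTriangulated] [P.IsClosedUnderIsomorphisms] :
    (extensionProduct P P.rightOrthogonal).IsTriangulated := by
  have h₁ : extensionProduct P P ≤ P :=
    extensionProduct_le_of_isTriangulatedClosed₂ le_rfl le_rfl
  have h₂ : extensionProduct P.rightOrthogonal P.rightOrthogonal ≤ P.rightOrthogonal :=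
    extensionProduct_le_of_isTriangulatedClosed₂ le_rfl le_rfl
  have h : extensionProduct (extensionProduct P P.rightOrthogonal)
      (extensionProduct P P.rightOrthogonal) ≤ extensionProduct P P.rightOrthogonal := by
    rw [extensionProduct_assoc, ← extensionProduct_assoc P.rightOrthogonal]
    refine (monotone_extensionProduct_right _ (monotone_extensionProduct_left _
      (extensionProduct_rightOrthogonal_le P))).trans ?_
    rw [extensionProduct_assoc, ← extensionProduct_assoc]
    exact (monotone_extensionProduct_left _ h₁).trans (monotone_extensionProduct_right _ h₂)
  have : (extensionProduct P P.rightOrthogonal).IsTriangulatedClosed₂ :=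
    .mk' fun T hT hT₁ hT₃ => h _ ⟨_, _, _, _, _, hT, hT₁, hT₃⟩
  have : (extensionProduct P P.rightOrthogonal).ContainsZero :=
    ⟨_, isZero_zero D, le_extensionProduct_left _ _ (P.prop_of_isZero (isZero_zero D))⟩
  exact {}

end Orthogonal

/-! ### Complexes with terms in `𝒳` in the homotopy category -/

section HomotopyCategory

variable {A : Type u} [Category.{v} A] [Abelian A]

/-- The class of cochain complexes all of whose terms lie in `𝒳`. -/
def termwise (𝒳 : ObjectProperty A) : ObjectProperty (CochainComplex A ℤ) :=
  fun K => ∀ n : ℤ, 𝒳 (K.X n)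

/-- The class of objects of the homotopy category isomorphic to a complex with terms in `𝒳`. -/
def termwiseH (𝒳 : ObjectProperty A) :
    ObjectProperty (HomotopyCategory A (ComplexShape.up ℤ)) :=
  (termwise 𝒳).map (HomotopyCategory.quotient A (ComplexShape.up ℤ))

instance (𝒳 : ObjectProperty A) : (termwiseH 𝒳).IsClosedUnderIsomorphisms := by
  unfold termwiseH; infer_instance

variable {𝒳 𝒴 : ObjectProperty A}

open HomotopyCategory in
lemma rightOrthogonal_termwiseH_iff (K : CochainComplex A ℤ) :
    (termwiseH 𝒳).rightOrthogonal ((quotient A _).obj K) ↔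
      ∀ (Q : CochainComplex A ℤ) (_ : termwise 𝒳 Q) (f : Q ⟶ K), (quotient A _).map f = 0 := by
  constructor
  · intro h Q hQ f
    exact h _ (ObjectProperty.prop_map_obj _ _ hQ)
  · rintro h X f ⟨Q, hQ, ⟨e⟩⟩
    obtain ⟨g, hg⟩ := (quotient A _).map_surjective (e.hom ≫ f)
    rw [← cancel_epi e.hom, ← hg, h Q hQ g, comp_zero]

variable [𝒳.IsStableUnderRetracts]

open HomotopyCategory Pretriangulated in
lemma IsAdmissibleBalancedPair.isTriangulated_termwiseH (hXY : IsAdmissibleBalancedPair 𝒳 𝒴) :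
    (termwiseH 𝒳).IsTriangulated := by
  have : (termwiseH 𝒳).ContainsZero := by
    refine ⟨_, (quotient A (ComplexShape.up ℤ)).map_isZero
      (isZero_zero (CochainComplex A ℤ)), ObjectProperty.prop_map_obj _ _ fun n => ?_⟩
    exact hXY.mem_of_isZero
      ((HomologicalComplex.eval A (ComplexShape.up ℤ) n).map_isZero (isZero_zero _))
  have : (termwiseH 𝒳).IsStableUnderShift ℤ :=
    { isStableUnderShiftBy := fun n => ⟨by
        rintro X ⟨K, hK, ⟨e⟩⟩
        exact ⟨K⟦n⟧, fun k => hK (k + n), ⟨((quotient A (ComplexShape.up ℤ)).commShiftIso n).app K ≪≫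
          (shiftFunctor _ n).mapIso e⟩⟩⟩ }
  have : (termwiseH 𝒳).IsTriangulatedClosed₃ := .mk' (by
    rintro T hT ⟨K, hK, ⟨e⟩⟩ ⟨L, hL, ⟨e'⟩⟩
    obtain ⟨φ, hφ⟩ := (quotient A (ComplexShape.up ℤ)).map_surjective (e.hom ≫ T.mor₁ ≫ e'.inv)
    refine ⟨CochainComplex.mappingCone φ, fun n => ?_, ⟨?_⟩⟩
    · refine hXY.mem_of_splitting
        (CochainComplex.mappingCone.triangleRotateShortComplexSplitting φ n) (hL n) (hK (n + 1))
    · exact Triangle.π₃.mapIso (isoTriangleOfIso₁₂ _ T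
        (mappingCone_triangleh_distinguished φ) hT e e' (by
          change (quotient A (ComplexShape.up ℤ)).map φ ≫ e'.hom = e.hom ≫ T.mor₁
          rw [hφ, Category.assoc, Category.assoc, e'.inv_hom_id, Category.comp_id])))
  have : (termwiseH 𝒳).IsTriangulatedClosed₂ :=
    ObjectProperty.IsTriangulatedClosed₂.of_isTriangulatedClosed₃
  exact {}

end HomotopyCategory

/-! ### Degreewise split sequences -/

section DegreewiseSplit

variable {A : Type u} [Category.{v} A] [Abelian A] {κ : Type*} {c : ComplexShape κ}

/-- A pair of composable morphisms of complexes which is split exact in each degree. -/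
def DegreewiseSplit {K L M : HomologicalComplex A c} (f : K ⟶ L) (g : L ⟶ M) : Prop :=
  ∀ n, ∃ (r : L.X n ⟶ K.X n) (s : M.X n ⟶ L.X n),
    f.f n ≫ r = 𝟙 _ ∧ s ≫ g.f n = 𝟙 _ ∧ r ≫ f.f n + g.f n ≫ s = 𝟙 _

lemma DegreewiseSplit.nonempty_splitting {S : ShortComplex (HomologicalComplex A c)}
    (h : DegreewiseSplit S.f S.g) (n : κ) :
    Nonempty ((S.map (HomologicalComplex.eval A c n)).Splitting) := by
  obtain ⟨r, s, hr, hs, h⟩ := h n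
  exact ⟨⟨r, s, hr, hs, h⟩⟩

lemma degreewiseSplit_of_splitting {S : ShortComplex (HomologicalComplex A c)}
    (h : ∀ n, Nonempty ((S.map (HomologicalComplex.eval A c n)).Splitting)) :
    DegreewiseSplit S.f S.g := by
  intro n
  obtain ⟨σ⟩ := h n
  exact ⟨σ.r, σ.s, σ.f_r, σ.s_g, σ.id⟩

end DegreewiseSplit

/-! ### Degreewise coproducts of complexes -/

section Sigma

variable {A : Type u} [Category.{v} A] [Abelian A] [HasCoproducts.{v} A]
  {κ : Type*} {c : ComplexShape κ} {ι : Type v}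

/-- The degreewise coproduct of a family of complexes. -/
noncomputable def sigmaComplex (K : ι → HomologicalComplex A c) : HomologicalComplex A c where
  X n := ∐ fun i => (K i).X n
  d m n := Sigma.desc fun i => (K i).d m n ≫ Sigma.ι (fun i => (K i).X n) i
  shape m n h := by ext i; simp [(K i).shape m n h]
  d_comp_d' _ _ _ _ _ := by ext; simp

/-- The morphism out of a term of a degreewise coproduct given by its components. -/
noncomputable def sigmaXDesc (K : ι → HomologicalComplex A c) {n : κ} {Z : A}
    (g : ∀ i, (K i).X n ⟶ Z) : (sigmaComplex K).X n ⟶ Z :=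
  Sigma.desc g

/-- The inclusion of a summand of a degreewise coproduct. -/
noncomputable def sigmaι (K : ι → HomologicalComplex A c) (i : ι) : K i ⟶ sigmaComplex K where
  f n := Sigma.ι (fun i => (K i).X n) i
  comm' m n _ := Sigma.ι_desc (fun i => (K i).d m n ≫ Sigma.ι (fun i => (K i).X n) i) i

@[simp]
lemma sigmaι_sigmaXDesc (K : ι → HomologicalComplex A c) {n : κ} {Z : A}
    (g : ∀ i, (K i).X n ⟶ Z) (i : ι) : (sigmaι K i).f n ≫ sigmaXDesc K g = g i :=
  Sigma.ι_desc g i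

@[simp]
lemma sigmaι_sigmaXDesc_assoc (K : ι → HomologicalComplex A c) {n : κ} {Z Z' : A}
    (g : ∀ i, (K i).X n ⟶ Z) (i : ι) (h : Z ⟶ Z') :
    (sigmaι K i).f n ≫ sigmaXDesc K g ≫ h = g i ≫ h := by
  rw [← Category.assoc, sigmaι_sigmaXDesc]

lemma sigmaX_hom_ext {K : ι → HomologicalComplex A c} {n : κ} {Z : A}
    {a b : (sigmaComplex K).X n ⟶ Z} (h : ∀ i, (sigmaι K i).f n ≫ a = (sigmaι K i).f n ≫ b) :
    a = b :=
  Sigma.hom_ext _ _ h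

/-- The morphism out of a degreewise coproduct given by its components. -/
@[simps]
noncomputable def sigmaDesc (K : ι → HomologicalComplex A c) {L : HomologicalComplex A c}
    (g : ∀ i, K i ⟶ L) : sigmaComplex K ⟶ L where
  f n := sigmaXDesc K fun i => (g i).f n
  comm' m n _ := sigmaX_hom_ext fun i => by
    rw [sigmaι_sigmaXDesc_assoc, (g i).comm, (sigmaι K i).comm_assoc, sigmaι_sigmaXDesc]

/-- The degreewise coproduct is a coproduct in the category of complexes. -/
noncomputable def isColimitSigma (K : ι → HomologicalComplex A c) :
    IsColimit (Cofan.mk (sigmaComplex K) (sigmaι K)) :=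
  Cofan.IsColimit.mk _ (fun s => sigmaDesc K s.inj) (fun s i => by ext; simp)
    (fun s m hm => by
      ext n
      refine sigmaX_hom_ext fun i => ?_
      simpa using HomologicalComplex.congr_hom (hm i) n)

/-- The morphism between degreewise coproducts given by a family of morphisms. -/
noncomputable def sigmaMap {K L : ι → HomologicalComplex A c} (f : ∀ i, K i ⟶ L i) :
    sigmaComplex K ⟶ sigmaComplex L :=
  sigmaDesc _ fun i => f i ≫ sigmaι L i

@[simp]
lemma sigmaι_sigmaMap_f {K L : ι → HomologicalComplex A c} (f : ∀ i, K i ⟶ L i) (i : ι) (n : κ) :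
    (sigmaι K i).f n ≫ (sigmaMap f).f n = (f i).f n ≫ (sigmaι L i).f n := by
  simp [sigmaMap]

@[simp]
lemma sigmaι_sigmaMap_f_assoc {K L : ι → HomologicalComplex A c} (f : ∀ i, K i ⟶ L i) (i : ι)
    (n : κ) {Z : A} (h : (sigmaComplex L).X n ⟶ Z) :
    (sigmaι K i).f n ≫ (sigmaMap f).f n ≫ h = (f i).f n ≫ (sigmaι L i).f n ≫ h := by
  simp [sigmaMap]

lemma DegreewiseSplit.sigma {K L M : ι → HomologicalComplex A c} {f : ∀ i, K i ⟶ L i}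
    {g : ∀ i, L i ⟶ M i} (h : ∀ i, DegreewiseSplit (f i) (g i)) :
    DegreewiseSplit (sigmaMap f) (sigmaMap g) := by
  intro n
  choose r s hr hs hrs using fun i => h i n
  refine ⟨sigmaXDesc L fun i => r i ≫ (sigmaι K i).f n,
    sigmaXDesc M fun i => s i ≫ (sigmaι L i).f n,
    sigmaX_hom_ext fun i => ?_, sigmaX_hom_ext fun i => ?_, sigmaX_hom_ext fun i => ?_⟩
  · simp [reassoc_of% hr i]
  · simp [reassoc_of% hs i]
  · have h := congr($(hrs i) ≫ (sigmaι L i).f n)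
    simpa using h

lemma sigmaMap_comp_eq_zero {K L M : ι → HomologicalComplex A c} {f : ∀ i, K i ⟶ L i}
    {g : ∀ i, L i ⟶ M i} (h : ∀ i, f i ≫ g i = 0) : sigmaMap f ≫ sigmaMap g = 0 := by
  ext n
  refine sigmaX_hom_ext fun i => ?_
  have := HomologicalComplex.congr_hom (h i) n
  rw [HomologicalComplex.comp_f, HomologicalComplex.zero_f] at this
  simp [reassoc_of% this]

end Sigma

/-! ### Telescopes of degreewise stationary sequences -/

section Telescope

variable {A : Type u} [Category.{v} A]

/-- Every map out of `∐ T n` extends along the identity minus the shift. From `N` on the equations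
are solved forwards by inverting `t n`, with an arbitrary start; below `N` they are solved
backwards. -/
lemma exists_telescope_lift [Preadditive A] {Z : A} (N : ℕ) (T : ℕ → A) (t : ∀ n, T n ⟶ T (n + 1))
    (ht : ∀ n, N ≤ n → IsIso (t n)) (g : ∀ n, T n ⟶ Z) :
    ∃ h : ∀ n, T n ⟶ Z, ∀ n, h n - t n ≫ h (n + 1) = g n := by
  induction N generalizing T with
  | zero =>
    have (n : ℕ) : IsIso (t n) := ht n n.zero_le
    exact ⟨fun n => Nat.rec 0 (fun n x => inv (t n) ≫ (x - g n)) n, fun n => by simp⟩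
  | succ N ih =>
    obtain ⟨h, hh⟩ := ih (fun n => T (n + 1)) (fun n => t (n + 1))
      (fun n hn => ht _ (by lia)) (fun n => g (n + 1))
    refine ⟨fun n => match n with
      | 0 => g 0 + t 0 ≫ h 0
      | n + 1 => h n, fun n => ?_⟩
    match n with
    | 0 => simp
    | n + 1 => exact hh n

/-- An eventually constant sequence has its eventual value as colimit, whatever `A` is. -/
lemma exists_telescope_desc {M Z : A} (N : ℕ) (T : ℕ → A) (t : ∀ n, T n ⟶ T (n + 1))
    (φ : ∀ n, T n ⟶ M) (hφ : ∀ n, t n ≫ φ (n + 1) = φ n) (ht : ∀ n, N ≤ n → IsIso (φ n))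
    (h : ∀ n, T n ⟶ Z) (hh : ∀ n, t n ≫ h (n + 1) = h n) :
    ∃ k : M ⟶ Z, ∀ n, φ n ≫ k = h n := by
  induction N generalizing T with
  | zero =>
    have (n : ℕ) : IsIso (φ n) := ht n n.zero_le
    have (n : ℕ) : IsIso (t n) := by
      have : IsIso (t n ≫ φ (n + 1)) := by rw [hφ]; infer_instance
      exact IsIso.of_isIso_comp_right (t n) (φ (n + 1))
    refine ⟨inv (φ 0) ≫ h 0, fun n => ?_⟩
    induction n with
    | zero => simp
    | succ n ih => rw [← cancel_epi (t n), reassoc_of% hφ n, ih, hh]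
  | succ N ih =>
    obtain ⟨k, hk⟩ := ih (fun n => T (n + 1)) (fun n => t (n + 1)) (fun n => φ (n + 1))
      (fun n => hφ _) (fun n hn => ht _ (by lia)) (fun n => h (n + 1)) (fun n => hh _)
    refine ⟨k, fun n => ?_⟩
    match n with
    | 0 => rw [← hφ, Category.assoc, hk, hh]
    | n + 1 => exact hk n

variable [Abelian A] [HasCoproducts.{v} A] {κ : Type*} {c : ComplexShape κ}
  (T : ℕ → HomologicalComplex A c)

/-- The coproduct of a sequence of complexes. -/
noncomputable abbrev seqSigma : HomologicalComplex A c :=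
  sigmaComplex fun n : ULift.{v} ℕ => T n.down

/-- The inclusion of a term in the coproduct of a sequence of complexes. -/
noncomputable abbrev seqι (n : ℕ) : T n ⟶ seqSigma T :=
  sigmaι (fun n : ULift.{v} ℕ => T n.down) ⟨n⟩

/-- The difference of the identity and the shift on the coproduct of a sequence of complexes. -/
noncomputable def telescopeMap (t : ∀ n, T n ⟶ T (n + 1)) : seqSigma T ⟶ seqSigma T :=
  sigmaDesc _ fun n => seqι T n.down - t n.down ≫ seqι T (n.down + 1)

/-- The morphism from the coproduct of a sequence of complexes given by its components. -/
noncomputable def seqDesc {M : HomologicalComplex A c} (φ : ∀ n, T n ⟶ M) : seqSigma T ⟶ M :=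
  sigmaDesc _ fun n => φ n.down

variable {T} (t : ∀ n, T n ⟶ T (n + 1)) {M : HomologicalComplex A c} (φ : ∀ n, T n ⟶ M)

lemma seqX_hom_ext {k : κ} {Z : A} {a b : (seqSigma T).X k ⟶ Z}
    (h : ∀ n, (seqι T n).f k ≫ a = (seqι T n).f k ≫ b) : a = b :=
  sigmaX_hom_ext fun n => h n.down

lemma seqι_telescopeMap_f (n : ℕ) (k : κ) : (seqι T n).f k ≫ (telescopeMap T t).f k =
    (seqι T n).f k - (t n).f k ≫ (seqι T (n + 1)).f k :=
  sigmaι_sigmaXDesc _ _ _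

lemma seqι_seqDesc_f (n : ℕ) (k : κ) : (seqι T n).f k ≫ (seqDesc T φ).f k = (φ n).f k :=
  sigmaι_sigmaXDesc _ _ _

variable {t φ} (hφ : ∀ n, t n ≫ φ (n + 1) = φ n)
include hφ

lemma telescopeMap_seqDesc : telescopeMap T t ≫ seqDesc T φ = 0 := by
  ext k
  refine seqX_hom_ext fun n => ?_
  rw [HomologicalComplex.comp_f, reassoc_of% seqι_telescopeMap_f, Preadditive.sub_comp,
    Category.assoc, seqι_seqDesc_f, seqι_seqDesc_f, ← HomologicalComplex.comp_f, hφ, sub_self,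
    HomologicalComplex.zero_f, comp_zero]

lemma degreewiseSplit_telescope (h : ∀ k, ∃ N, ∀ n, N ≤ n → IsIso ((φ n).f k)) :
    DegreewiseSplit (telescopeMap T t) (seqDesc T φ) := by
  intro k
  obtain ⟨N, h⟩ := h k
  have hφ' (n : ℕ) : (t n).f k ≫ (φ (n + 1)).f k = (φ n).f k :=
    HomologicalComplex.congr_hom (hφ n) k
  have ht (n : ℕ) (hn : N ≤ n) : IsIso ((t n).f k) := by
    have := h n hn
    have := h (n + 1) (by lia)
    have : IsIso ((t n).f k ≫ (φ (n + 1)).f k) := by rw [hφ']; infer_instance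
    exact IsIso.of_isIso_comp_right _ ((φ (n + 1)).f k)
  have hN := h N le_rfl
  obtain ⟨r, hr⟩ := exists_telescope_lift N (fun n => (T n).X k) (fun n => (t n).f k) ht
    (fun n => (seqι T n).f k)
  let ρ : (seqSigma T).X k ⟶ (seqSigma T).X k := sigmaXDesc _ fun n => r n.down
  have hιρ (n : ℕ) : (seqι T n).f k ≫ ρ = r n := sigmaι_sigmaXDesc _ _ _
  have hρ : (telescopeMap T t).f k ≫ ρ = 𝟙 _ := seqX_hom_ext fun n => by
    rw [reassoc_of% seqι_telescopeMap_f, Preadditive.sub_comp, Category.assoc, hιρ, hιρ, hr,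
      Category.comp_id]
  -- Since `ρ` is a retraction, the complementary idempotent kills the telescope map. It thus
  -- descends to the colimit `(M).X k`, and the descended map is the section.
  have hker : (telescopeMap T t).f k ≫ (𝟙 _ - ρ ≫ (telescopeMap T t).f k) = 0 := by
    rw [Preadditive.comp_sub, reassoc_of% hρ, Category.comp_id, sub_self]
  obtain ⟨b, hb⟩ := exists_telescope_desc N (fun n => (T n).X k) (fun n => (t n).f k)
    (fun n => (φ n).f k) hφ' h
    (fun n => (seqι T n).f k ≫ (𝟙 _ - ρ ≫ (telescopeMap T t).f k)) (fun n => by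
      have := congr((seqι T n).f k ≫ $hker)
      rw [reassoc_of% seqι_telescopeMap_f, Preadditive.sub_comp, Category.assoc, comp_zero,
        sub_eq_zero] at this
      exact this.symm)
  have hb' : (seqDesc T φ).f k ≫ b = 𝟙 _ - ρ ≫ (telescopeMap T t).f k :=
    seqX_hom_ext fun n => by rw [reassoc_of% seqι_seqDesc_f, hb]
  refine ⟨ρ, b, hρ, ?_, by rw [hb']; simp⟩
  have hg : (telescopeMap T t).f k ≫ (seqDesc T φ).f k = 0 := by
    rw [← HomologicalComplex.comp_f, telescopeMap_seqDesc hφ, HomologicalComplex.zero_f]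
  rw [← cancel_epi ((φ N).f k), reassoc_of% hb N, Preadditive.sub_comp, Category.assoc, hg,
    comp_zero, sub_zero, Category.id_comp, seqι_seqDesc_f, Category.comp_id]

end Telescope

/-! ### Objects admitting an envelope triangle, and their closure properties -/

section Envelope

open HomotopyCategory Pretriangulated ObjectProperty

variable {A : Type u} [Category.{v} A] [Abelian A]

lemma DegreewiseSplit.exists_distinguished {K L M : CochainComplex A ℤ} {f : K ⟶ L} {g : L ⟶ M}
    (h : DegreewiseSplit f g) (zero : f ≫ g = 0) :
    ∃ δ, Triangle.mk ((quotient A (ComplexShape.up ℤ)).map f)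
      ((quotient A (ComplexShape.up ℤ)).map g) δ ∈ distTriang _ :=
  ⟨_, (distinguished_iff_iso_trianglehOfDegreewiseSplit _).2
    ⟨ShortComplex.mk f g zero,
      fun n => (h.nonempty_splitting (S := ShortComplex.mk f g zero) n).some, ⟨Iso.refl _⟩⟩⟩

lemma degreewiseSplit_mappingCone {K L : CochainComplex A ℤ} (f : K ⟶ L) :
    DegreewiseSplit (CochainComplex.mappingCone.inr f)
      (CochainComplex.mappingCone.triangle f).mor₃ :=
  degreewiseSplit_of_splitting
    (S := CochainComplex.mappingCone.triangleRotateShortComplex f)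
    fun n => ⟨CochainComplex.mappingCone.triangleRotateShortComplexSplitting f n⟩

variable {𝒳 𝒴 : ObjectProperty A}

/-- The class of objects `M` of the homotopy category for which there is a distinguished triangle
`P ⟶ M ⟶ W` with `P` a complex with terms in `𝒳` and `W` right orthogonal to all such complexes. -/
def HasEnvelope (𝒳 : ObjectProperty A) :
    ObjectProperty (HomotopyCategory A (ComplexShape.up ℤ)) :=
  extensionProduct (termwiseH 𝒳) (termwiseH 𝒳).rightOrthogonal

instance : (HasEnvelope 𝒳).IsClosedUnderIsomorphisms := by
  unfold HasEnvelope; infer_instance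

lemma HasEnvelope.exists_mappingCone {M : CochainComplex A ℤ}
    (hM : HasEnvelope 𝒳 ((quotient A _).obj M)) :
    ∃ (P : CochainComplex A ℤ) (f : P ⟶ M), termwise 𝒳 P ∧
      (termwiseH 𝒳).rightOrthogonal ((quotient A _).obj (CochainComplex.mappingCone f)) := by
  obtain ⟨P', W, f, g, h, hT, ⟨P, hP, ⟨e⟩⟩, hW⟩ := hM
  obtain ⟨φ, hφ⟩ := (quotient A _).map_surjective (e.hom ≫ f)
  refine ⟨P, φ, hP, (termwiseH 𝒳).rightOrthogonal.prop_of_iso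
    (Triangle.π₃.mapIso (isoTriangleOfIso₁₂ _ _ (mappingCone_triangleh_distinguished φ) hT
      e (Iso.refl _) ?_)).symm hW⟩
  change (quotient A _).map φ ≫ 𝟙 _ = e.hom ≫ f
  rw [hφ, Category.comp_id]

lemma hasEnvelope_of_termwise {P : CochainComplex A ℤ}
    (hP : termwise 𝒳 P) : HasEnvelope 𝒳 ((quotient A _).obj P) :=
  le_extensionProduct_left _ _ (ObjectProperty.prop_map_obj _ _ hP)

variable [𝒳.IsStableUnderRetracts] (hXY : IsAdmissibleBalancedPair 𝒳 𝒴)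
include hXY

lemma IsAdmissibleBalancedPair.isTriangulated_hasEnvelope : (HasEnvelope 𝒳).IsTriangulated := by
  have := hXY.isTriangulated_termwiseH
  exact isTriangulated_extensionProduct_rightOrthogonal _

lemma IsAdmissibleBalancedPair.hasEnvelope_of_rightOrthogonal {W : CochainComplex A ℤ}
    (hW : (termwiseH 𝒳).rightOrthogonal ((quotient A _).obj W)) :
    HasEnvelope 𝒳 ((quotient A _).obj W) := by
  have := hXY.isTriangulated_termwiseH
  exact le_extensionProduct_right _ _ hW

section

variable {K L M : CochainComplex A ℤ} {f : K ⟶ L} {g : L ⟶ M} (h : DegreewiseSplit f g)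
  (zero : f ≫ g = 0)
include h zero

lemma IsAdmissibleBalancedPair.hasEnvelope_X₁ (hL : HasEnvelope 𝒳 ((quotient A _).obj L))
    (hM : HasEnvelope 𝒳 ((quotient A _).obj M)) : HasEnvelope 𝒳 ((quotient A _).obj K) := by
  have := hXY.isTriangulated_hasEnvelope
  obtain ⟨δ, hδ⟩ := h.exists_distinguished zero
  exact (HasEnvelope 𝒳).ext_of_isTriangulatedClosed₁ _ hδ hL hM

lemma IsAdmissibleBalancedPair.hasEnvelope_X₂ (hK : HasEnvelope 𝒳 ((quotient A _).obj K))
    (hM : HasEnvelope 𝒳 ((quotient A _).obj M)) : HasEnvelope 𝒳 ((quotient A _).obj L) := by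
  have := hXY.isTriangulated_hasEnvelope
  obtain ⟨δ, hδ⟩ := h.exists_distinguished zero
  exact (HasEnvelope 𝒳).ext_of_isTriangulatedClosed₂ _ hδ hK hM

lemma IsAdmissibleBalancedPair.hasEnvelope_X₃ (hK : HasEnvelope 𝒳 ((quotient A _).obj K))
    (hL : HasEnvelope 𝒳 ((quotient A _).obj L)) : HasEnvelope 𝒳 ((quotient A _).obj M) := by
  have := hXY.isTriangulated_hasEnvelope
  obtain ⟨δ, hδ⟩ := h.exists_distinguished zero
  exact (HasEnvelope 𝒳).ext_of_isTriangulatedClosed₃ _ hδ hK hL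

end

variable [HasCoproducts.{v} A]

/-- The coproduct of the cone sequences `T i ⟶ cone (f i) ⟶ (P i)[1]` is again degreewise split. Its
middle term is right orthogonal by `hsum` and its last term has terms in `𝒳`. -/
lemma IsAdmissibleBalancedPair.hasEnvelope_sigma {ι : Type v}
    (hsum : ∀ K : ι → CochainComplex A ℤ,
      (∀ i, (termwiseH 𝒳).rightOrthogonal ((quotient A _).obj (K i))) →
        (termwiseH 𝒳).rightOrthogonal ((quotient A _).obj (sigmaComplex K)))
    (T : ι → CochainComplex A ℤ) (hT : ∀ i, HasEnvelope 𝒳 ((quotient A _).obj (T i))) :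
    HasEnvelope 𝒳 ((quotient A _).obj (sigmaComplex T)) := by
  choose P f hP hf using fun i => (hT i).exists_mappingCone
  refine hXY.hasEnvelope_X₁ (DegreewiseSplit.sigma fun i => degreewiseSplit_mappingCone (f i))
    (sigmaMap_comp_eq_zero fun i => by simp)
    (hXY.hasEnvelope_of_rightOrthogonal (hsum _ hf))
    (hasEnvelope_of_termwise fun n => ?_)
  exact hXY.mem_sigma _ fun i => hP i _

lemma IsAdmissibleBalancedPair.hasEnvelope_of_sequence
    (hsum : ∀ K : ULift.{v} ℕ → CochainComplex A ℤ,
      (∀ i, (termwiseH 𝒳).rightOrthogonal ((quotient A _).obj (K i))) →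
        (termwiseH 𝒳).rightOrthogonal ((quotient A _).obj (sigmaComplex K)))
    {T : ℕ → CochainComplex A ℤ} {t : ∀ n, T n ⟶ T (n + 1)} {M : CochainComplex A ℤ}
    {φ : ∀ n, T n ⟶ M} (hφ : ∀ n, t n ≫ φ (n + 1) = φ n)
    (h : ∀ k, ∃ N, ∀ n, N ≤ n → IsIso ((φ n).f k))
    (hT : ∀ n, HasEnvelope 𝒳 ((quotient A _).obj (T n))) :
    HasEnvelope 𝒳 ((quotient A _).obj M) := by
  have := hXY.hasEnvelope_sigma hsum (fun n => T n.down) fun n => hT _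
  exact hXY.hasEnvelope_X₃ (degreewiseSplit_telescope hφ h) (telescopeMap_seqDesc hφ) this this

end Envelope

/-! ### Envelopes of bounded complexes -/

section Bounded

variable {A : Type u} [Category.{v} A] [Abelian A]

/-- The top term of a complex bounded above is a subcomplex. Splitting it off drives the induction
on length, and separates `M` from its resolution in the augmented complex. -/
lemma exists_degreewiseSplit_single (M : CochainComplex A ℤ) (b : ℤ)
    (hM : ∀ k, b < k → IsZero (M.X k)) :
    ∃ (Q : CochainComplex A ℤ)
      (f : (HomologicalComplex.single A (ComplexShape.up ℤ) b).obj (M.X b) ⟶ M) (g : M ⟶ Q),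
      f ≫ g = 0 ∧ DegreewiseSplit f g ∧ (∀ k, b ≤ k → IsZero (Q.X k)) ∧
        ∀ k, k < b → Nonempty (M.X k ≅ Q.X k) := by
  let f : (HomologicalComplex.single A (ComplexShape.up ℤ) b).obj (M.X b) ⟶ M :=
    HomologicalComplex.mkHomFromSingle (𝟙 _) fun k hk =>
      (hM k (by have : b + 1 = k := hk; lia)).eq_of_tgt _ _
  let g := cokernel.π f
  have zero : f ≫ g = 0 := cokernel.condition f
  have hexact : (ShortComplex.mk f g zero).Exact := ShortComplex.exact_cokernel f
  have hexact' (k : ℤ) : (ShortComplex.mk (f.f k) (g.f k) (by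
      rw [← HomologicalComplex.comp_f, zero, HomologicalComplex.zero_f])).Exact :=
    hexact.map (HomologicalComplex.eval A (ComplexShape.up ℤ) k)
  have hepi (k : ℤ) : Epi (g.f k) :=
    inferInstanceAs (Epi ((HomologicalComplex.eval A (ComplexShape.up ℤ) k).map g))
  have hf : IsIso (f.f b) := by
    have : f.f b = _ := HomologicalComplex.mkHomFromSingle_f _ _
    rw [this]
    infer_instance
  have hz (k : ℤ) (hk : k ≠ b) :
      IsZero (((HomologicalComplex.single A (ComplexShape.up ℤ) b).obj (M.X b)).X k) :=
    HomologicalComplex.isZero_single_obj_X _ _ _ _ hk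
  have hg (k : ℤ) (hk : k ≠ b) : IsIso (g.f k) := by
    have : Mono (g.f k) := (hexact' k).mono_g ((hz k hk).eq_of_src _ _)
    exact isIso_of_mono_of_epi _
  have hzero : g.f b = 0 := by
    rw [← cancel_epi (f.f b), ← HomologicalComplex.comp_f, zero, HomologicalComplex.zero_f,
      comp_zero]
  have hQb : IsZero ((cokernel f).X b) := by
    rw [IsZero.iff_id_eq_zero, ← cancel_epi (g.f b), hzero, zero_comp, zero_comp]
  refine ⟨_, f, g, zero, fun k => ?_, fun k hk => ?_, fun k hk => ?_⟩
  · by_cases hk : k = b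
    · subst hk
      exact ⟨inv (f.f k), 0, by simp, hQb.eq_of_src _ _, by simp⟩
    · have := hg k hk
      exact ⟨0, inv (g.f k), (hz k hk).eq_of_src _ _, by simp, by simp⟩
  · obtain rfl | hk := hk.eq_or_lt
    · exact hQb
    · have := hg k hk.ne'
      exact (hM k hk).of_iso (asIso (g.f k)).symm
  · have := hg k hk.ne
    exact ⟨asIso (g.f k)⟩

open HomotopyCategory

variable {𝒳 𝒴 : ObjectProperty A} [𝒳.IsStableUnderRetracts]
  (hXY : IsAdmissibleBalancedPair 𝒳 𝒴)
include hXY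

open ComplexShape in
lemma IsAdmissibleBalancedPair.hasEnvelope_single (M : A) (b : ℤ) :
    HasEnvelope 𝒳 ((quotient A _).obj ((HomologicalComplex.single A (up ℤ) b).obj M)) := by
  have h₀ : HasEnvelope 𝒳 ((quotient A _).obj ((HomologicalComplex.single A (up ℤ) 0).obj M)) := by
    obtain ⟨P, ε, w, hP, hac, -⟩ := hXY.resolution M
    let L := (P.augment ε w).extend embeddingDownNat
    have hL : (termwiseH 𝒳).rightOrthogonal ((quotient A _).obj L) := by
      rw [rightOrthogonal_termwiseH_iff]
      intro Q hQ f
      exact (quotient_map_eq_zero_iff f).2 (hac.nonempty_homotopy_zero_extend hQ f)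
    obtain ⟨Q, f, g, zero, h, hQ, hQ'⟩ := exists_degreewiseSplit_single L 0 fun k hk =>
      (P.augment ε w).isZero_extend_X embeddingDownNat k fun i => by change -(i : ℤ) ≠ k; lia
    have := hXY.hasEnvelope_X₁ h zero (hXY.hasEnvelope_of_rightOrthogonal hL)
      (hasEnvelope_of_termwise fun k => by
        by_cases hk : 0 ≤ k
        · exact hXY.mem_of_isZero (hQ k hk)
        · obtain ⟨e⟩ := hQ' k (by lia)
          -- Index 0 of the augmented complex is `M` itself, so degree `-(n + 1)` holds `P.X n`.
          obtain ⟨n, rfl⟩ : ∃ n : ℕ, k = -((n + 1 : ℕ) : ℤ) := ⟨(-k - 1).toNat, by lia⟩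
          exact 𝒳.prop_of_iso (((P.augment ε w).extendXIso embeddingDownNat
            (i := n + 1) (by simp)).symm ≪≫ e) (hP n))
    exact (HasEnvelope 𝒳).prop_of_iso ((quotient A _).mapIso
      ((HomologicalComplex.single A (up ℤ) 0).mapIso
        ((P.augment ε w).extendXIso embeddingDownNat (i := 0) (by simp)))) this
  have := hXY.isTriangulated_hasEnvelope
  refine (HasEnvelope 𝒳).prop_of_iso (((quotient A (up ℤ)).commShiftIso (-b)).symm.app _ ≪≫
    (quotient A (up ℤ)).mapIso
      (((CochainComplex.singleFunctors A).shiftIso (-b) b 0 (by lia)).app M))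
    ((HasEnvelope 𝒳).le_shift (-b) _ h₀)

lemma IsAdmissibleBalancedPair.hasEnvelope_of_bounded (n : ℕ) (M : CochainComplex A ℤ) (a : ℤ)
    (h₁ : ∀ k, k < a → IsZero (M.X k)) (h₂ : ∀ k, a + n ≤ k → IsZero (M.X k)) :
    HasEnvelope 𝒳 ((quotient A _).obj M) := by
  induction n generalizing M with
  | zero =>
    have := hXY.isTriangulated_hasEnvelope
    refine (HasEnvelope 𝒳).prop_of_isZero ((quotient A _).map_isZero ?_)
    rw [IsZero.iff_id_eq_zero]
    ext k
    by_cases hk : k < a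
    · exact (h₁ k hk).eq_of_src _ _
    · exact (h₂ k (by lia)).eq_of_src _ _
  | succ n ih =>
    obtain ⟨Q, f, g, zero, h, hQ, hQ'⟩ := exists_degreewiseSplit_single M (a + n) fun k hk =>
      h₂ k (by lia)
    refine hXY.hasEnvelope_X₂ h zero (hXY.hasEnvelope_single _ _) (ih Q (fun k hk => ?_) hQ)
    obtain ⟨e⟩ := hQ' k (by lia)
    exact (h₁ k hk).of_iso e.symm

end Bounded

/-! ### Exhausting a complex by bounded subcomplexes -/

section BoundedPart

variable {A : Type u} [Category.{v} A] [Abelian A] (M : CochainComplex A ℤ)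

/-- A morphism whose kernel in degree `k` is the term of the subcomplex `boundedPart M n`. -/
noncomputable def boundedPartCond (n : ℕ) (k : ℤ) : M.X k ⟶ M.X (k + 1) ⊞ M.X k :=
  -- The first component imposes the cycle condition from degree `n` on, the second kills the
  -- degrees outside `[-n, n]`. A single kernel makes the terms uniform in `k`.
  biprod.lift (if k < n then 0 else M.d k (k + 1)) (if -n ≤ k ∧ k ≤ n then 0 else 𝟙 _)

lemma comp_boundedPartCond_eq_zero_iff (n : ℕ) (k : ℤ) {Z : A} (x : Z ⟶ M.X k) :
    x ≫ boundedPartCond M n k = 0 ↔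
      (n ≤ k → x ≫ M.d k (k + 1) = 0) ∧ (¬ (-n ≤ k ∧ k ≤ n) → x = 0) := by
  have (a : M.X k ⟶ M.X (k + 1)) (b : M.X k ⟶ M.X k) :
      x ≫ biprod.lift a b = 0 ↔ x ≫ a = 0 ∧ x ≫ b = 0 :=
    ⟨fun h => ⟨by simpa using congr($h ≫ biprod.fst), by simpa using congr($h ≫ biprod.snd)⟩,
      fun ⟨h₁, h₂⟩ => by ext <;> simp [h₁, h₂]⟩
  rw [boundedPartCond, this]
  congr! 1
  · split_ifs with h
    · simp [h]
    · simp [not_lt.1 h]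
  · split_ifs with h
    · simp [h]
    · simp [h]

/-- The subcomplex of `M` which agrees with `M` in the degrees `-n ≤ k < n`, consists of the
cycles in degree `n` and is zero elsewhere. -/
noncomputable def boundedPart (n : ℕ) : CochainComplex A ℤ where
  X k := kernel (boundedPartCond M n k)
  d i j := kernel.lift _ (kernel.ι _ ≫ M.d i j) (by
    by_cases hij : i + 1 = j
    · subst hij
      have h := (comp_boundedPartCond_eq_zero_iff M n i _).1
        (kernel.condition (boundedPartCond M n i))
      rw [comp_boundedPartCond_eq_zero_iff]
      refine ⟨fun _ => by simp, fun h' => ?_⟩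
      by_cases hi : n ≤ i
      · exact h.1 hi
      · rw [h.2 (by lia), zero_comp]
    · rw [M.shape _ _ hij]; simp)
  shape i j hij := by
    rw [← cancel_mono (kernel.ι _)]
    simp [M.shape _ _ hij]
  d_comp_d' i j k _ _ := by
    rw [← cancel_mono (kernel.ι _)]
    simp

/-- The inclusion of `boundedPart M n` in `M`. -/
noncomputable def boundedPartι (n : ℕ) : boundedPart M n ⟶ M where
  f k := kernel.ι (boundedPartCond M n k)
  comm' _ _ _ := (kernel.lift_ι _ _ _).symm

instance (n : ℕ) (k : ℤ) : Mono ((boundedPartι M n).f k) :=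
  inferInstanceAs (Mono (kernel.ι (boundedPartCond M n k)))

lemma boundedPartι_f_comp_cond (n : ℕ) (k : ℤ) :
    (n ≤ k → (boundedPartι M n).f k ≫ M.d k (k + 1) = 0) ∧
      (¬ (-n ≤ k ∧ k ≤ n) → (boundedPartι M n).f k = 0) :=
  (comp_boundedPartCond_eq_zero_iff M n k _).1 (kernel.condition (boundedPartCond M n k))

lemma exists_comp_boundedPartι_f (n : ℕ) (k : ℤ) {Z : A} (x : Z ⟶ M.X k)
    (h₁ : n ≤ k → x ≫ M.d k (k + 1) = 0) (h₂ : ¬ (-n ≤ k ∧ k ≤ n) → x = 0) :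
    ∃ y : Z ⟶ (boundedPart M n).X k, y ≫ (boundedPartι M n).f k = x :=
  ⟨kernel.lift _ x ((comp_boundedPartCond_eq_zero_iff M n k x).2 ⟨h₁, h₂⟩), kernel.lift_ι _ _ _⟩

lemma isZero_boundedPart_X (n : ℕ) (k : ℤ) (h : ¬ (-n ≤ k ∧ k ≤ n)) :
    IsZero ((boundedPart M n).X k) := by
  rw [IsZero.iff_id_eq_zero, ← cancel_mono ((boundedPartι M n).f k),
    (boundedPartι_f_comp_cond M n k).2 h, comp_zero, comp_zero]

lemma isIso_boundedPartι_f (n : ℕ) (k : ℤ) (h₁ : -n ≤ k) (h₂ : k < n) :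
    IsIso ((boundedPartι M n).f k) := by
  obtain ⟨y, hy⟩ := exists_comp_boundedPartι_f M n k (𝟙 _) (fun _ => by lia) (fun h => by lia)
  exact ⟨y, by rw [← cancel_mono ((boundedPartι M n).f k), Category.assoc, hy]; simp, hy⟩

lemma exists_boundedPart_hom (n : ℕ) :
    ∃ t : boundedPart M n ⟶ boundedPart M (n + 1), t ≫ boundedPartι M (n + 1) = boundedPartι M n := by
  choose t ht using fun k => exists_comp_boundedPartι_f M (n + 1) k ((boundedPartι M n).f k)
    (fun hk => (boundedPartι_f_comp_cond M n k).1 (by lia))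
    (fun hk => (boundedPartι_f_comp_cond M n k).2 (by lia))
  refine ⟨⟨t, fun i j _ => ?_⟩, by ext k; exact ht k⟩
  rw [← cancel_mono ((boundedPartι M (n + 1)).f j), Category.assoc, Category.assoc, ht,
    ← (boundedPartι M (n + 1)).comm, reassoc_of% ht, (boundedPartι M n).comm]

open HomotopyCategory in
lemma IsAdmissibleBalancedPair.hasEnvelope [HasCoproducts.{v} A] {𝒳 𝒴 : ObjectProperty A}
    [𝒳.IsStableUnderRetracts] (hXY : IsAdmissibleBalancedPair 𝒳 𝒴)
    (hsum : ∀ K : ULift.{v} ℕ → CochainComplex A ℤ,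
      (∀ i, (termwiseH 𝒳).rightOrthogonal ((quotient A _).obj (K i))) →
        (termwiseH 𝒳).rightOrthogonal ((quotient A _).obj (sigmaComplex K))) :
    HasEnvelope 𝒳 ((quotient A _).obj M) := by
  choose t ht using exists_boundedPart_hom M
  -- In degree `n` only cycles are kept, so stability in degree `k` needs `k < n` strictly; hence
  -- the `+ 1`.
  refine hXY.hasEnvelope_of_sequence hsum ht (fun k => ⟨k.natAbs + 1, fun n hn => ?_⟩) fun n => ?_
  · exact isIso_boundedPartι_f M n k (by lia) (by lia)
  · exact hXY.hasEnvelope_of_bounded (2 * n + 1) _ (-n)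
      (fun k hk => isZero_boundedPart_X M n k (by lia))
      (fun k hk => isZero_boundedPart_X M n k (by lia))

end BoundedPart

/-! ### Relative `Ext¹` as orthogonality in the homotopy category -/

section ChainComplexes

variable {A : Type u} [Category.{v} A] [Abelian A] {𝒳 𝒴 : ObjectProperty A}

lemma chRelExact_of_degreewiseSplit {S : ShortComplex (ChainComplex A ℤ)}
    (h : DegreewiseSplit S.f S.g) : chRelExact 𝒳 S := by
  have h' (n : ℤ) : relExact 𝒳 (S.map (HomologicalComplex.eval A (ComplexShape.down ℤ) n)) :=
    relExact_of_splitting (h.nonempty_splitting n).some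
  exact ⟨HomologicalComplex.shortExact_of_degreewise_shortExact _ fun n => (h' n).1, h'⟩

lemma chRelExact.degreewiseSplit {S : ShortComplex (ChainComplex A ℤ)} (hS : chRelExact 𝒳 S)
    (h₃ : dw 𝒳 S.X₃) : DegreewiseSplit S.f S.g :=
  degreewiseSplit_of_splitting fun n => (hS.2 n).nonempty_splitting (h₃ n)

lemma subsingleton_ext1_iff (X K : ChainComplex A ℤ) :
    Subsingleton (Ext1 (chRelExact 𝒳) X K) ↔
      ∀ e : Extension (chRelExact 𝒳) X K, ∃ r : e.mid ⟶ K, e.i ≫ r = 𝟙 K := by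
  constructor
  · intro _ e
    let e₀ : Extension (chRelExact 𝒳) X K :=
      { mid := K ⊞ X
        i := biprod.inl
        p := biprod.snd
        zero := by simp
        mem := chRelExact_of_degreewiseSplit fun n =>
          ⟨(biprod.fst : K ⊞ X ⟶ K).f n, (biprod.inr : X ⟶ K ⊞ X).f n,
            by rw [← HomologicalComplex.comp_f]; simp,
            by rw [← HomologicalComplex.comp_f]; simp,
            by
              rw [← HomologicalComplex.comp_f, ← HomologicalComplex.comp_f,
                ← HomologicalComplex.add_f_apply, biprod.total, HomologicalComplex.id_f]⟩ }
    have h : (Quotient.mk (extensionSetoid (chRelExact 𝒳) X K) e) = Quotient.mk _ e₀ :=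
      Subsingleton.elim (α := Ext1 (chRelExact 𝒳) X K) _ _
    obtain ⟨φ, h₁, -⟩ := Quotient.exact h
    exact ⟨φ.hom ≫ (biprod.fst : K ⊞ X ⟶ K), by rw [reassoc_of% h₁]; simp [e₀]⟩
  · intro h
    refine ⟨fun a b => Quotient.inductionOn₂ a b fun e e' => Quotient.sound ?_⟩
    obtain ⟨r, hr⟩ := h e
    obtain ⟨r', hr'⟩ := h e'
    let σ := ShortComplex.Splitting.ofExactOfRetraction _ e'.mem.1.exact r' hr' e'.mem.1.epi_g
    have hs : σ.s ≫ e'.p = 𝟙 _ := σ.s_g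
    let φ : e.mid ⟶ e'.mid := r ≫ e'.i + e.p ≫ σ.s
    have h₁ : e.i ≫ φ = e'.i := by
      simp [φ, reassoc_of% hr, reassoc_of% e.zero]
    have h₂ : φ ≫ e'.p = e.p := by
      simp [φ, hs, e'.zero]
    let Φ : ShortComplex.mk e.i e.p e.zero ⟶ ShortComplex.mk e'.i e'.p e'.zero :=
      { τ₁ := 𝟙 _, τ₂ := φ, τ₃ := 𝟙 _, comm₁₂ := by simp [h₁], comm₂₃ := by simp [h₂] }
    have : IsIso Φ.τ₁ := inferInstanceAs (IsIso (𝟙 K))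
    have : IsIso Φ.τ₃ := inferInstanceAs (IsIso (𝟙 X))
    have : IsIso φ := ShortComplex.isIso₂_of_shortExact_of_isIso₁₃ Φ e.mem.1 e'.mem.1
    exact ⟨asIso φ, h₁, h₂⟩

open HomotopyCategory Pretriangulated

/-- The passage from chain complexes to cochain complexes by negating degrees. -/
noncomputable abbrev toCochain (A : Type u) [Category.{v} A] [Abelian A] :
    ChainComplex A ℤ ≌ CochainComplex A ℤ :=
  ChainComplex.cochainComplexEquivalence A

lemma DegreewiseSplit.map_functor {K L M : ChainComplex A ℤ} {f : K ⟶ L} {g : L ⟶ M}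
    (h : DegreewiseSplit f g) :
    DegreewiseSplit ((toCochain A).functor.map f) ((toCochain A).functor.map g) :=
  fun n => h (-n)

lemma DegreewiseSplit.map_inverse {K L M : CochainComplex A ℤ} {f : K ⟶ L} {g : L ⟶ M}
    (h : DegreewiseSplit f g) :
    DegreewiseSplit ((toCochain A).inverse.map f) ((toCochain A).inverse.map g) :=
  fun n => h (-n)

lemma DegreewiseSplit.iso_comp {κ : Type*} {c : ComplexShape κ}
    {K' K L M : HomologicalComplex A c} {f : K ⟶ L} {g : L ⟶ M}
    (h : DegreewiseSplit f g) (e : K' ≅ K) : DegreewiseSplit (e.hom ≫ f) g := by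
  intro n
  obtain ⟨r, s, h₁, h₂, h₃⟩ := h n
  have he : e.hom.f n ≫ e.inv.f n = 𝟙 _ := by
    rw [← HomologicalComplex.comp_f, e.hom_inv_id, HomologicalComplex.id_f]
  have he' : e.inv.f n ≫ e.hom.f n = 𝟙 _ := by
    rw [← HomologicalComplex.comp_f, e.inv_hom_id, HomologicalComplex.id_f]
  refine ⟨r ≫ e.inv.f n, s, ?_, h₂, ?_⟩
  · rw [HomologicalComplex.comp_f, Category.assoc, reassoc_of% h₁, he]
  · rw [HomologicalComplex.comp_f, Category.assoc, reassoc_of% he', h₃]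

lemma termwise_functor {Q : ChainComplex A ℤ} (hQ : dw 𝒳 Q) :
    termwise 𝒳 ((toCochain A).functor.obj Q) := fun n => hQ (-n)

lemma dw_inverse {Q : CochainComplex A ℤ} (hQ : termwise 𝒳 Q) :
    dw 𝒳 ((toCochain A).inverse.obj Q) := fun n => hQ (-n)

/-- The degreewise retractions extend the homotopy from `K` to `L`. Subtracting the resulting
null-homotopic map turns a retraction up to homotopy into a strict one. -/
lemma DegreewiseSplit.exists_retraction_of_homotopy {K L M : CochainComplex A ℤ} {f : K ⟶ L}
    {g : L ⟶ M} (h : DegreewiseSplit f g) (ρ : L ⟶ K) (H : Homotopy (f ≫ ρ) (𝟙 K)) :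
    ∃ r : L ⟶ K, f ≫ r = 𝟙 K := by
  choose r _ hr _ using h
  refine ⟨ρ - Homotopy.nullHomotopicMap fun i j => r i ≫ H.hom i j, ?_⟩
  rw [Preadditive.comp_sub, Homotopy.comp_nullHomotopicMap, sub_eq_iff_eq_add]
  ext n
  have := H.comm n
  simp only [reassoc_of% hr]
  rw [this, add_comm, HomologicalComplex.add_f_apply, Homotopy.nullHomotopicMap]

lemma exists_retraction_of_rightOrthogonal [𝒳.IsStableUnderRetracts]
    (hXY : IsAdmissibleBalancedPair 𝒳 𝒴) {K L Q : CochainComplex A ℤ} {f : K ⟶ L} {g : L ⟶ Q}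
    (h : DegreewiseSplit f g) (zero : f ≫ g = 0) (hQ : termwise 𝒳 Q)
    (hK : (termwiseH 𝒳).rightOrthogonal ((quotient A _).obj K)) :
    ∃ r : L ⟶ K, f ≫ r = 𝟙 K := by
  have := hXY.isTriangulated_termwiseH
  obtain ⟨δ, hδ⟩ := h.exists_distinguished zero
  obtain ⟨e, he, -⟩ := exists_iso_binaryBiproduct_of_distTriang _ hδ
    ((termwiseH 𝒳).rightOrthogonal.le_shift (1 : ℤ) _ hK δ (ObjectProperty.prop_map_obj _ _ hQ))
  obtain ⟨ρ', hρ'⟩ : ∃ ρ' : (quotient A _).obj L ⟶ (quotient A _).obj K,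
      (quotient A _).map f ≫ ρ' = 𝟙 _ := by
    have he' := congr($he ≫ biprod.fst)
    rw [Category.assoc, biprod.inl_fst] at he'
    exact ⟨_, he'⟩
  obtain ⟨ρ, rfl⟩ := (quotient A _).map_surjective ρ'
  exact h.exists_retraction_of_homotopy ρ (homotopyOfEq _ _ (by
    rw [Functor.map_comp, hρ', CategoryTheory.Functor.map_id]))

/-- Every morphism from a complex with terms in `𝒳` becomes null-homotopic after a degreewise split
monomorphism whose cokernel has terms in `𝒳`. -/
lemma exists_degreewiseSplit_of_hom {Q K : CochainComplex A ℤ} (hQ : termwise 𝒳 Q) (f : Q ⟶ K) :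
    ∃ (L Q' : CochainComplex A ℤ) (j : K ⟶ L) (p : L ⟶ Q'), j ≫ p = 0 ∧ DegreewiseSplit j p ∧
      termwise 𝒳 Q' ∧ (quotient A _).map f ≫ (quotient A _).map j = 0 :=
  ⟨_, _, _, _, CochainComplex.mappingCone.inr_triangleδ f, degreewiseSplit_mappingCone f,
    fun n => hQ (n + 1), comp_distTriang_mor_zero₁₂ _ (mappingCone_triangleh_distinguished f)⟩

/-- If `Ext¹` vanishes, the cone sequence of `f : Q ⟶ K` splits; as `f` dies in its cone, `f` is
null-homotopic. Conversely, orthogonality kills the connecting map of a degreewise split extension,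
which then has a retraction up to homotopy, hence a strict one. -/
lemma rightPerp_iff_rightOrthogonal [𝒳.IsStableUnderRetracts]
    (hXY : IsAdmissibleBalancedPair 𝒳 𝒴) (K : ChainComplex A ℤ) :
    rightPerp (chRelExact 𝒳) (dw 𝒳) K ↔
      (termwiseH 𝒳).rightOrthogonal ((quotient A _).obj ((toCochain A).functor.obj K)) := by
  simp only [rightPerp, subsingleton_ext1_iff]
  constructor
  · intro h
    rw [rightOrthogonal_termwiseH_iff]
    intro Q hQ f
    obtain ⟨L, Q', j, p, zero, hjp, hQ', hfj⟩ := exists_degreewiseSplit_of_hom hQ f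
    obtain ⟨r, hr⟩ : ∃ r : (toCochain A).inverse.obj L ⟶ K,
        ((toCochain A).unit.app K ≫ (toCochain A).inverse.map j) ≫ r = 𝟙 K :=
      h ((toCochain A).inverse.obj Q') (dw_inverse hQ')
        { mid := (toCochain A).inverse.obj L
          i := (toCochain A).unit.app K ≫ (toCochain A).inverse.map j
          p := (toCochain A).inverse.map p
          zero := by rw [Category.assoc, ← Functor.map_comp, zero, Functor.map_zero, comp_zero]
          mem := chRelExact_of_degreewiseSplit
            (hjp.map_inverse.iso_comp ((toCochain A).unitIso.app K)) }
    have hρ : j ≫ (toCochain A).counitInv.app L ≫ (toCochain A).functor.map r = 𝟙 _ := by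
      rw [← (toCochain A).functor.map_id, ← hr, Functor.map_comp, Functor.map_comp,
        ← (toCochain A).counitInv_app_functor, Category.assoc]
      exact (toCochain A).counitInv.naturality_assoc j _
    have h1 := congr((quotient A _).map $hρ)
    rw [Functor.map_comp, CategoryTheory.Functor.map_id] at h1
    rw [← Category.comp_id ((quotient A _).map f), ← h1, reassoc_of% hfj, zero_comp]
  · intro h X hX e
    obtain ⟨r, hr⟩ := exists_retraction_of_rightOrthogonal hXY
      (e.mem.degreewiseSplit hX).map_functor
      (by rw [← Functor.map_comp]; simp [e.zero]) (termwise_functor hX) h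
    obtain ⟨r, rfl⟩ := (toCochain A).functor.map_surjective r
    exact ⟨r, (toCochain A).functor.map_injective (by simpa using hr)⟩

lemma rightOrthogonal_iff_rightPerp [𝒳.IsStableUnderRetracts]
    (hXY : IsAdmissibleBalancedPair 𝒳 𝒴) (K : CochainComplex A ℤ) :
    (termwiseH 𝒳).rightOrthogonal ((quotient A _).obj K) ↔
      rightPerp (chRelExact 𝒳) (dw 𝒳) ((toCochain A).inverse.obj K) := by
  rw [rightPerp_iff_rightOrthogonal hXY]
  exact ((termwiseH 𝒳).rightOrthogonal.prop_iff_of_iso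
    ((quotient A _).mapIso ((toCochain A).counitIso.app K))).symm

end ChainComplexes

/-! ### Pushouts and pullbacks of short exact sequences -/

section Squares

variable {C : Type u} [Category.{v} C] [Abelian C]

lemma shortExact_of_isPushout {S : ShortComplex C} (hS : S.ShortExact) {W Z : C} {a : S.X₁ ⟶ W}
    {inl : S.X₂ ⟶ Z} {inr : W ⟶ Z} (sq : IsPushout S.f a inl inr) {p : Z ⟶ S.X₃}
    (h₁ : inl ≫ p = S.g) (h₂ : inr ≫ p = 0) : (ShortComplex.mk inr p h₂).ShortExact := by
  have := hS.mono_f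
  have := hS.epi_g
  refine .mk' ?_ (MorphismProperty.of_isPushout (P := .monomorphisms C) sq.flip
    (.infer_property S.f)) (epi_of_epi_fac h₁)
  rw [ShortComplex.exact_iff_exact_up_to_refinements]
  intro T x hx
  obtain ⟨T', π, _, x₂, w, hx'⟩ := sq.hom_eq_add_up_to_refinements x
  have hx₂ : x₂ ≫ S.g = 0 := by
    have h := congr($hx' ≫ p)
    rw [Category.assoc, Preadditive.add_comp, Category.assoc, Category.assoc, h₁, h₂, comp_zero,
      add_zero] at h
    rw [← h]
    exact (congr(π ≫ $hx)).trans comp_zero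
  obtain ⟨T'', π', _, x₁, hx₁⟩ := hS.exact.exact_up_to_refinements x₂ hx₂
  refine ⟨T'', π' ≫ π, inferInstance, x₁ ≫ a + π' ≫ w, ?_⟩
  rw [Category.assoc, hx', Preadditive.comp_add, reassoc_of% hx₁, sq.w, Preadditive.add_comp,
    Category.assoc, Category.assoc]

lemma shortExact_of_isPullback {S : ShortComplex C} (hS : S.ShortExact) {P Q : C} {f : Q ⟶ S.X₃}
    {fst : P ⟶ S.X₂} {snd : P ⟶ Q} (sq : IsPullback fst snd S.g f) {i : S.X₁ ⟶ P}
    (h₁ : i ≫ fst = S.f) (h₂ : i ≫ snd = 0) : (ShortComplex.mk i snd h₂).ShortExact := by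
  have := hS.mono_f
  have := hS.epi_g
  refine .mk' ?_ (mono_of_mono_fac h₁) (MorphismProperty.of_isPullback (P := .epimorphisms C) sq
    (.infer_property S.g))
  rw [ShortComplex.exact_iff_exact_up_to_refinements]
  intro T x hx
  have hx : x ≫ snd = 0 := hx
  obtain ⟨T', π, _, x₁, hx₁⟩ := hS.exact.exact_up_to_refinements (x ≫ fst)
    (by rw [Category.assoc, sq.w, reassoc_of% hx, zero_comp])
  refine ⟨T', π, inferInstance, x₁, sq.hom_ext ?_ ?_⟩
  · simp only [Category.assoc, h₁, hx₁]
  · simp only [Category.assoc, h₂, hx, comp_zero]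

end Squares

/-! ### Approximation sequences and the cotorsion pair -/

section Cotorsion

variable {A : Type u} [Category.{v} A] [Abelian A] {𝒳 𝒴 : ObjectProperty A}

lemma chRelExact_of_exists_lift {S : ShortComplex (ChainComplex A ℤ)} (hS : S.ShortExact)
    (h : ∀ (n : ℤ) (X : A) (_ : 𝒳 X) (g : X ⟶ S.X₃.X n), ∃ l : X ⟶ S.X₂.X n, l ≫ S.g.f n = g) :
    chRelExact 𝒳 S :=
  ⟨hS, fun n => relExact_of_exists_lift
    (hS.map_of_exact (HomologicalComplex.eval A (ComplexShape.down ℤ) n)) (h n)⟩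

lemma chRelExact.exists_lift {S : ShortComplex (ChainComplex A ℤ)} (hS : chRelExact 𝒳 S)
    {n : ℤ} {X : A} (hX : 𝒳 X) (g : X ⟶ S.X₃.X n) : ∃ l : X ⟶ S.X₂.X n, l ≫ S.g.f n = g :=
  relExact.exists_lift (hS.2 n) hX g

lemma chRelExact_of_isPushout {S : ShortComplex (ChainComplex A ℤ)} (hS : chRelExact 𝒳 S)
    {W Z : ChainComplex A ℤ} {a : S.X₁ ⟶ W}
    {inl : S.X₂ ⟶ Z} {inr : W ⟶ Z} (sq : IsPushout S.f a inl inr) {p : Z ⟶ S.X₃}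
    (h₁ : inl ≫ p = S.g) (h₂ : inr ≫ p = 0) : chRelExact 𝒳 (ShortComplex.mk inr p h₂) := by
  refine chRelExact_of_exists_lift (shortExact_of_isPushout hS.1 sq h₁ h₂) fun n X hX g => ?_
  obtain ⟨l, hl⟩ := hS.exists_lift hX g
  refine ⟨l ≫ inl.f n, ?_⟩
  change (l ≫ inl.f n) ≫ p.f n = g
  rw [Category.assoc, ← HomologicalComplex.comp_f, h₁, hl]

lemma chRelExact_of_isPullback {S : ShortComplex (ChainComplex A ℤ)} (hS : chRelExact 𝒳 S)
    {P Q : ChainComplex A ℤ} {f : Q ⟶ S.X₃}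
    {fst : P ⟶ S.X₂} {snd : P ⟶ Q} (sq : IsPullback fst snd S.g f) {i : S.X₁ ⟶ P}
    (h₁ : i ≫ fst = S.f) (h₂ : i ≫ snd = 0) : chRelExact 𝒳 (ShortComplex.mk i snd h₂) := by
  refine chRelExact_of_exists_lift (shortExact_of_isPullback hS.1 sq h₁ h₂) fun n X hX g => ?_
  obtain ⟨l, hl⟩ := hS.exists_lift hX (g ≫ f.f n)
  exact ⟨(sq.map (HomologicalComplex.eval A _ n)).lift l g hl,
    (sq.map (HomologicalComplex.eval A _ n)).lift_snd l g hl⟩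

lemma dw_of_chRelExact (hXY : IsAdmissibleBalancedPair 𝒳 𝒴) [𝒳.IsStableUnderRetracts]
    {S : ShortComplex (ChainComplex A ℤ)} (hS : chRelExact 𝒳 S) (h₁ : dw 𝒳 S.X₁)
    (h₃ : dw 𝒳 S.X₃) : dw 𝒳 S.X₂ := fun n =>
  hXY.mem_of_splitting ((hS.2 n).nonempty_splitting (h₃ n)).some (h₁ n) (h₃ n)

/-- Every complex is the target of an `ℰ`-admissible epimorphism from a contractible complex with
terms in `𝒳`. -/
lemma exists_chRelExact_of_dw (hXY : IsAdmissibleBalancedPair 𝒳 𝒴) [𝒳.IsStableUnderRetracts]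
    (M : ChainComplex A ℤ) : ∃ S : ShortComplex (ChainComplex A ℤ),
      S.X₃ = M ∧ chRelExact 𝒳 S ∧ dw 𝒳 S.X₂ := by
  choose X ε hX hε using fun n : ℤ => hXY.contravariantlyFinite (M.X n)
  -- `D` is the sum of the disks on the chosen approximations `X n`. Lifts to `D` use only the
  -- summand `X n` in degree `n`.
  let D : ChainComplex A ℤ := ChainComplex.of (fun n => X n ⊞ X (n + 1))
    (fun n => biprod.fst ≫ biprod.inr) (fun n => by simp)
  let π : D ⟶ M :=
    { f := fun n => biprod.desc (ε n) (ε (n + 1) ≫ M.d (n + 1) n)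
      comm' := by
        rintro _ n rfl
        have hd : D.d (n + 1) n = biprod.fst ≫ biprod.inr :=
          ChainComplex.of_d (fun n : ℤ => X n ⊞ X (n + 1)) (fun n => biprod.fst ≫ biprod.inr) n
        rw [hd]
        ext <;> simp }
  have hlift (n : ℤ) (X' : A) (g : X' ⟶ M.X n) (hX' : 𝒳 X') :
      ∃ h : X' ⟶ D.X n, h ≫ π.f n = g := by
    obtain ⟨h, hh⟩ := hε n X' g hX'
    exact ⟨h ≫ biprod.inl, by
      change (h ≫ biprod.inl) ≫ biprod.desc (ε n) (ε (n + 1) ≫ M.d (n + 1) n) = g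
      rw [Category.assoc, biprod.inl_desc, hh]⟩
  have (n : ℤ) : Epi (π.f n) := hXY.epi_of_exists_lift _ (hlift n)
  have : Epi π := HomologicalComplex.epi_of_epi_f π this
  refine ⟨ShortComplex.mk (kernel.ι π) π (kernel.condition π), rfl,
    chRelExact_of_exists_lift (.mk' ?_ inferInstance this) fun n X' hX' g => hlift n X' g hX',
    fun n => hXY.mem_biprod (hX n) (hX (n + 1))⟩
  exact ShortComplex.exact_of_f_is_kernel _ (kernelIsKernel π)

lemma sum_mem_rightOrthogonal [HasCoproducts.{v} A] [𝒳.IsStableUnderRetracts]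
    (hXY : IsAdmissibleBalancedPair 𝒳 𝒴) {ι : Type v}
    [(rightPerp (chRelExact 𝒳) (dw 𝒳)).IsClosedUnderColimitsOfShape (Discrete ι)]
    (K : ι → CochainComplex A ℤ)
    (hK : ∀ i, (termwiseH 𝒳).rightOrthogonal ((HomotopyCategory.quotient A _).obj (K i))) :
    (termwiseH 𝒳).rightOrthogonal ((HomotopyCategory.quotient A _).obj (sigmaComplex K)) := by
  rw [rightOrthogonal_iff_rightPerp hXY]
  exact ObjectProperty.prop_of_isColimit _
    (isColimitOfPreserves (toCochain A).inverse (isColimitSigma K))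
    fun i => (rightOrthogonal_iff_rightPerp hXY _).1 (hK i.as)

lemma exists_preenvelope [𝒳.IsStableUnderRetracts]
    (hXY : IsAdmissibleBalancedPair 𝒳 𝒴) (M : ChainComplex A ℤ)
    (hM : HasEnvelope 𝒳 ((HomotopyCategory.quotient A _).obj ((toCochain A).functor.obj M))) :
    ∃ (K X : ChainComplex A ℤ) (i : M ⟶ K) (p : K ⟶ X) (w : i ≫ p = 0),
      rightPerp (chRelExact 𝒳) (dw 𝒳) K ∧ dw 𝒳 X ∧ chRelExact 𝒳 (ShortComplex.mk i p w) := by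
  obtain ⟨L, Q, j, p, zero, hjp, hQ, hL⟩ :
      ∃ (L Q : CochainComplex A ℤ) (j : (toCochain A).functor.obj M ⟶ L) (p : L ⟶ Q),
        j ≫ p = 0 ∧ DegreewiseSplit j p ∧ termwise 𝒳 Q ∧
        (termwiseH 𝒳).rightOrthogonal ((HomotopyCategory.quotient A _).obj L) := by
    obtain ⟨P, f, hP, hf⟩ := hM.exists_mappingCone
    exact ⟨_, _, _, _, CochainComplex.mappingCone.inr_triangleδ f, degreewiseSplit_mappingCone f,
      fun n => hP (n + 1), hf⟩
  exact ⟨(toCochain A).inverse.obj L, (toCochain A).inverse.obj Q,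
    (toCochain A).unit.app M ≫ (toCochain A).inverse.map j, (toCochain A).inverse.map p,
    by rw [Category.assoc, ← Functor.map_comp, zero, Functor.map_zero, comp_zero],
    (rightOrthogonal_iff_rightPerp hXY L).1 hL, dw_inverse hQ,
    chRelExact_of_degreewiseSplit (hjp.map_inverse.iso_comp ((toCochain A).unitIso.app M))⟩

/-- Salce's argument: special precovers are obtained from special preenvelopes. -/
lemma exists_precover [𝒳.IsStableUnderRetracts]
    (hXY : IsAdmissibleBalancedPair 𝒳 𝒴) {G : ObjectProperty (ChainComplex A ℤ)}
    (henv : ∀ M, ∃ (K X : ChainComplex A ℤ) (i : M ⟶ K) (p : K ⟶ X) (w : i ≫ p = 0),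
      G K ∧ dw 𝒳 X ∧ chRelExact 𝒳 (ShortComplex.mk i p w)) (M : ChainComplex A ℤ) :
    ∃ (X K : ChainComplex A ℤ) (i : K ⟶ X) (p : X ⟶ M) (w : i ≫ p = 0),
      dw 𝒳 X ∧ G K ∧ chRelExact 𝒳 (ShortComplex.mk i p w) := by
  obtain ⟨S, rfl, hS, hX⟩ := exists_chRelExact_of_dw hXY M
  obtain ⟨K, Q, i, p, w, hK, hQ, hip⟩ := henv S.X₁
  have sq := IsPushout.of_hasPushout S.f i
  let a : pushout S.f i ⟶ S.X₃ := pushout.desc S.g 0 (by rw [S.zero, comp_zero])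
  let b : pushout S.f i ⟶ Q := pushout.desc 0 p (by rw [w, comp_zero])
  -- The pushout is an extension of `Q` by `S.X₂`, both with terms in `𝒳`, and also an extension of
  -- `S.X₃` by `K`.
  have hb : chRelExact 𝒳 (ShortComplex.mk (pushout.inl S.f i) b (pushout.inl_desc _ _ _)) :=
    chRelExact_of_isPushout hip sq.flip (pushout.inr_desc _ _ _) (pushout.inl_desc _ _ _)
  exact ⟨pushout S.f i, K, pushout.inr S.f i, a, pushout.inr_desc _ _ _,
    dw_of_chRelExact hXY hb hX hQ, hK,
    chRelExact_of_isPushout hS sq (pushout.inl_desc _ _ _) (pushout.inr_desc _ _ _)⟩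

lemma dw_of_degreewiseSplit_left [𝒳.IsStableUnderRetracts] {K L M : ChainComplex A ℤ} {f : K ⟶ L}
    {g : L ⟶ M} (h : DegreewiseSplit f g) (hL : dw 𝒳 L) : dw 𝒳 K := fun n => by
  obtain ⟨r, _, hr, -⟩ := h n
  exact 𝒳.prop_of_retract ⟨f.f n, r, hr⟩ (hL n)

lemma exists_lift_of_rightPerp {S : ShortComplex (ChainComplex A ℤ)} (hS : chRelExact 𝒳 S)
    (h₁ : rightPerp (chRelExact 𝒳) (dw 𝒳) S.X₁) {Q : ChainComplex A ℤ} (hQ : dw 𝒳 Q)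
    (f : Q ⟶ S.X₃) : ∃ l : Q ⟶ S.X₂, l ≫ S.g = f := by
  let i : S.X₁ ⟶ pullback S.g f := pullback.lift S.f 0 (by rw [S.zero, zero_comp])
  let e : Extension (chRelExact 𝒳) Q S.X₁ :=
    { mid := pullback S.g f
      i := i
      p := pullback.snd S.g f
      zero := pullback.lift_snd _ _ _
      mem := chRelExact_of_isPullback hS (IsPullback.of_hasPullback S.g f)
        (pullback.lift_fst _ _ _) (pullback.lift_snd _ _ _) }
  obtain ⟨r, hr⟩ := (subsingleton_ext1_iff _ _).1 (h₁ Q hQ) e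
  let σ := ShortComplex.Splitting.ofExactOfRetraction _ e.mem.1.exact r hr e.mem.1.epi_g
  have hσ : σ.s ≫ pullback.snd S.g f = 𝟙 Q := σ.s_g
  exact ⟨σ.s ≫ pullback.fst S.g f, by
    rw [Category.assoc, pullback.condition, reassoc_of% hσ]⟩

/-- A map `Q ⟶ S.X₃` lifts to `S.X₂` because `Ext¹(Q, S.X₁) = 0`, and any map `Q ⟶ S.X₂` is
null-homotopic. No triangle is available here, since the sequence need not split in each degree. -/
lemma rightPerp_cokernel [𝒳.IsStableUnderRetracts] (hXY : IsAdmissibleBalancedPair 𝒳 𝒴)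
    {S : ShortComplex (ChainComplex A ℤ)} (hS : chRelExact 𝒳 S)
    (h₁ : rightPerp (chRelExact 𝒳) (dw 𝒳) S.X₁) (h₂ : rightPerp (chRelExact 𝒳) (dw 𝒳) S.X₂) :
    rightPerp (chRelExact 𝒳) (dw 𝒳) S.X₃ := by
  rw [rightPerp_iff_rightOrthogonal hXY, rightOrthogonal_termwiseH_iff] at h₂ ⊢
  intro Q hQ φ
  obtain ⟨l, hl⟩ := exists_lift_of_rightPerp hS h₁ (dw_inverse hQ)
    ((toCochain A).inverse.map φ ≫ (toCochain A).unitInv.app S.X₃)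
  have hφ : φ = ((toCochain A).counitInv.app Q ≫ (toCochain A).functor.map l) ≫
      (toCochain A).functor.map S.g := by
    rw [Category.assoc, ← Functor.map_comp, hl, Functor.map_comp]
    have h := (toCochain A).counitInv.naturality_assoc φ
      ((toCochain A).functor.map ((toCochain A).unitInv.app S.X₃))
    refine Eq.trans ?_ h
    rw [(toCochain A).counitInv_functor_comp]
    exact (Category.comp_id φ).symm
  rw [hφ, Functor.map_comp, h₂ Q hQ, zero_comp]

lemma eq_leftPerp [𝒳.IsStableUnderRetracts]
    (hcov : ∀ M, ∃ (X K : ChainComplex A ℤ) (i : K ⟶ X) (p : X ⟶ M) (w : i ≫ p = 0),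
      dw 𝒳 X ∧ rightPerp (chRelExact 𝒳) (dw 𝒳) K ∧ chRelExact 𝒳 (ShortComplex.mk i p w)) :
    dw 𝒳 = leftPerp (chRelExact 𝒳) (rightPerp (chRelExact 𝒳) (dw 𝒳)) := by
  refine le_antisymm (fun X hX K hK => hK X hX) fun M hM n => ?_
  obtain ⟨X, K, i, p, w, hX, hK, hip⟩ := hcov M
  obtain ⟨r, hr⟩ := (subsingleton_ext1_iff _ _).1 (hM K hK) ⟨X, i, p, w, hip⟩
  let σ := ShortComplex.Splitting.ofExactOfRetraction _ hip.1.exact r hr hip.1.epi_g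
  have hσ : σ.s ≫ p = 𝟙 M := σ.s_g
  exact 𝒳.prop_of_retract ⟨σ.s.f n, p.f n, by
    rw [← HomologicalComplex.comp_f, hσ, HomologicalComplex.id_f]⟩ (hX n)

end Cotorsion

end RelComplexes

theorem proposition4p7 {A : Type u} [Category.{v} A] [Abelian A] [HasLimits A] [HasColimits A]
    (𝒳 𝒴 : ObjectProperty A) [𝒳.IsStableUnderRetracts] [𝒴.IsStableUnderRetracts]
    (hXY : RelComplexes.IsAdmissibleBalancedPair 𝒳 𝒴)
    (hsum : ∀ ι : Type v,
      (RelComplexes.rightPerp (RelComplexes.chRelExact 𝒳)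
        (RelComplexes.dw 𝒳)).IsClosedUnderColimitsOfShape (Discrete ι)) :
    RelComplexes.IsCotorsionPair (RelComplexes.chRelExact 𝒳) (RelComplexes.dw 𝒳)
        (RelComplexes.rightPerp (RelComplexes.chRelExact 𝒳) (RelComplexes.dw 𝒳)) ∧
      RelComplexes.IsHereditary (RelComplexes.chRelExact 𝒳) (RelComplexes.dw 𝒳)
        (RelComplexes.rightPerp (RelComplexes.chRelExact 𝒳) (RelComplexes.dw 𝒳)) ∧
      RelComplexes.IsComplete (RelComplexes.chRelExact 𝒳) (RelComplexes.dw 𝒳)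
        (RelComplexes.rightPerp (RelComplexes.chRelExact 𝒳) (RelComplexes.dw 𝒳)) := by
  have := hsum (ULift.{v} ℕ)
  have henv (M : ChainComplex A ℤ) := RelComplexes.exists_preenvelope hXY M
    (RelComplexes.IsAdmissibleBalancedPair.hasEnvelope _ hXY
      (RelComplexes.sum_mem_rightOrthogonal hXY))
  have hcov := RelComplexes.exists_precover hXY henv
  exact ⟨⟨RelComplexes.eq_leftPerp hcov, rfl⟩,
    ⟨fun S hS h₂ h₃ => RelComplexes.dw_of_degreewiseSplit_left (hS.degreewiseSplit h₃) h₂,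
      fun S hS h₁ h₂ => RelComplexes.rightPerp_cokernel hXY hS h₁ h₂⟩, ⟨hcov, henv⟩⟩
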